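/- **Theorem 1.2.** Let $X$ be a compact connected complex manifold and $E\to X$ a holomorphic vector bundle of finite rank. Let $\mathcal O(E)$ be the (finite dimensional) complex vector space of holomorphic sections of $E$, and let $\mathcal H_E$ be the set of positive definite inner products on $\mathcal O(E)$, an open cone in the finite dimensional real vector space of all hermitian symmetric sesquilinear maps $\mathcal O(E)\times\mathcal O(E)\to\mathbb C$. Let $\overline E\to X$ be the conjugate bundle (the same real vector bundle, with $\lambda\in\mathbb C$ acting as $\overline\lambda$ does in $E$), and let $C^\infty(E\otimes\overline E)$ be the Fréchet space of smooth sections of $E\otimes_{\mathbb C}\overline E\to X$, with the topology of uniform convergence of all derivatives. For $\langle\,,\rangle\in\mathcal H_E$ put $$b(\langle\,,\rangle)=k,\qquad k(x)=\sum_{j=1}^d s_j(x)\otimes s_j(x)\quad(x\in X),$$ where $s_1,\dots,s_d$ is an orthonormal basis of $(\mathcal O(E),\langle\,,\rangle)$; $k$ does not depend on the choice of this basis. Then $b(\mathcal H_E)\subset C^\infty(E\otimes\overline E)$ is a submanifold, and $b$ is a diffeomorphism between $\mathcal H_E$ and its image. Here a map $f:U\to G$ from an open subset $U$ of a Fréchet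 space $F$ to a Fréchet space $G$ is $C^1$ if the directional derivatives $df(x,\xi)=\lim_{t\to0}(f(x+t\xi)-f(x))/t$ exist for all $x\in U$, $\xi\in F$ and define a continuous map $df:U\times F\to G$; it is $C^{k+1}$ if $df$ is $C^k$, and smooth if it is $C^k$ for all $k$. A subset $N$ of a Fréchet space $M$ is a (not necessarily closed) submanifold if every $x\in N$ has an open neighbourhood $U\subset M$ with a diffeomorphism $\Phi$ of $U$ onto an open neighbourhood $V$ of $0$ in some Fréchet space $F$ such that $\Phi(U\cap N)=V\cap G$ for some closed subspace $G\subset F$; the restrictions to $N$ of all such $\Phi$ are the charts of $N$. -/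

import Mathlib

open scoped Manifold ContDiff Topology Bundle TensorProduct ComplexConjugate
open Filter Set Bundle

namespace Bergman

/-! ### Calculus in Fréchet spaces -/

/-- Fréchet spaces over `ℝ`: complete metrizable locally convex topological vector spaces. -/
structure IsFrechetSpace (F : Type*) [AddCommGroup F] [Module ℝ F] [TopologicalSpace F] :
    Prop where
  isTopologicalAddGroup : IsTopologicalAddGroup F
  continuousSMul : ContinuousSMul ℝ F
  locallyConvexSpace : LocallyConvexSpace ℝ F
  metrizableSpace : TopologicalSpace.MetrizableSpace F
  complete : @CompleteSpace F (IsTopologicalAddGroup.rightUniformSpace F)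

/-- `IsCk k f U`: the map `f` is of class `C^k` on the open set `U` of a Fréchet space, in the sense
of Hamilton: the directional derivatives `df (x, ξ)` exist for `x ∈ U` and all `ξ`, and the
differential `df : U × F → G` is of class `C^(k-1)`; class `C^0` means continuous. -/
def IsCk {G : Type*} [AddCommGroup G] [Module ℝ G] [TopologicalSpace G] :
    ℕ → ∀ {F : Type*} [AddCommGroup F] [Module ℝ F] [TopologicalSpace F], (F → G) → Set F → Prop
  | 0, _, _, _, _, f, U => ContinuousOn f U
  | k + 1, F, _, _, _, f, U => ∃ df : F × F → G,
      (∀ x ∈ U, ∀ ξ : F,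
        Tendsto (fun t : ℝ => t⁻¹ • (f (x + t • ξ) - f x)) (𝓝[≠] 0) (𝓝 (df (x, ξ)))) ∧
      IsCk k df (U ×ˢ univ)

/-- Smooth maps on (open) subsets of Fréchet spaces. -/
def IsSmoothOn {F G : Type*} [AddCommGroup F] [Module ℝ F] [TopologicalSpace F]
    [AddCommGroup G] [Module ℝ G] [TopologicalSpace G] (f : F → G) (U : Set F) : Prop :=
  ∀ k : ℕ, IsCk k f U

section Submanifold

universe u v

variable {M : Type u} [AddCommGroup M] [Module ℝ M] [TopologicalSpace M]

/-- A chart adapted to `N ⊆ M`: a diffeomorphism `Φ` of an open set `Φ.source ⊆ M` onto an open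
neighbourhood `Φ.target` of `0 ∈ F` that maps `Φ.source ∩ N` onto `Φ.target ∩ G`, where `G` is a
closed subspace of `F`. -/
structure IsSubmanifoldChart (N : Set M) {F : Type*} [AddCommGroup F] [Module ℝ F]
    [TopologicalSpace F] (Φ : OpenPartialHomeomorph M F) (G : Submodule ℝ F) : Prop where
  zero_mem : (0 : F) ∈ Φ.target
  smooth : IsSmoothOn Φ Φ.source
  smooth_symm : IsSmoothOn Φ.symm Φ.target
  isClosed : IsClosed (G : Set F)
  image_eq : Φ '' (Φ.source ∩ N) = Φ.target ∩ G

/-- A (not necessarily closed) submanifold `N` of a Fréchet space `M`. -/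
def IsSubmanifold (N : Set M) : Prop :=
  ∀ x ∈ N, ∃ (F : Type u) (_ : AddCommGroup F) (_ : Module ℝ F) (_ : TopologicalSpace F),
    IsFrechetSpace F ∧ ∃ (Φ : OpenPartialHomeomorph M F) (G : Submodule ℝ F),
      x ∈ Φ.source ∧ IsSubmanifoldChart N Φ G

/-- `f` restricts to a diffeomorphism of the open subset `A` of the Fréchet space `P` onto the
submanifold `N ⊆ M`. The charts of `N` are the restrictions to `N` of the adapted charts `Φ`, with
values in the closed subspaces `G`; in each of them `f` and its inverse are given by smooth maps
`g` and `g'` between open subsets of `P` and of `G`. -/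
structure IsDiffeomorphismOnto {P : Type v} [AddCommGroup P] [Module ℝ P] [TopologicalSpace P]
    (f : P → M) (A : Set P) (N : Set M) : Prop where
  isOpen : IsOpen A
  bijOn : BijOn f A N
  smooth : ∀ (F : Type u) [AddCommGroup F] [Module ℝ F] [TopologicalSpace F], IsFrechetSpace F →
    ∀ (Φ : OpenPartialHomeomorph M F) (G : Submodule ℝ F), IsSubmanifoldChart N Φ G →
      IsOpen (A ∩ f ⁻¹' Φ.source) ∧
      (∃ g : P → G, (∀ p ∈ A ∩ f ⁻¹' Φ.source, (g p : F) = Φ (f p)) ∧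
        IsSmoothOn g (A ∩ f ⁻¹' Φ.source)) ∧
      (∃ g' : G → P, (∀ v : G, (v : F) ∈ Φ.target → g' v ∈ A ∧ f (g' v) = Φ.symm v) ∧
        IsSmoothOn g' {v : G | (v : F) ∈ Φ.target})

end Submanifold

/-! ### Inner products -/

section InnerProducts

variable (W : Type*) [AddCommGroup W] [Module ℂ W]

/-- The real vector space of all inner products on a complex vector space `W`, that is, of the
hermitian symmetric sesquilinear maps `W × W → ℂ`, not necessarily definite. -/
noncomputable def innerProducts : Submodule ℝ (W →ₗ[ℂ] W →ₛₗ[starRingEnd ℂ] ℂ) where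
  carrier := {h | ∀ s t, h s t = conj (h t s)}
  add_mem' {a b} ha hb s t := by
    rw [LinearMap.add_apply, LinearMap.add_apply, LinearMap.add_apply, LinearMap.add_apply,
      map_add, ← ha s t, ← hb s t]
  zero_mem' s t := by simp
  smul_mem' c a ha s t := by
    have h1 : (c • a) s t = (c : ℂ) * a s t := rfl
    have h2 : (c • a) t s = (c : ℂ) * a t s := rfl
    rw [h1, h2, map_mul, Complex.conj_ofReal, ← ha s t]

/-- See `innerProducts`. -/
noncomputable def InnerProducts : Type _ := innerProducts W

noncomputable instance : AddCommGroup (InnerProducts W) :=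
  inferInstanceAs (AddCommGroup (innerProducts W))

noncomputable instance : Module ℝ (InnerProducts W) :=
  inferInstanceAs (Module ℝ (innerProducts W))

variable {W}

/-- The value `⟨s, t⟩` of the inner product `h`. -/
noncomputable def InnerProducts.val (h : InnerProducts W) (s t : W) : ℂ := h.1 s t

/-- The topology of pointwise convergence. When `W` is finite dimensional, this is the unique
Hausdorff vector space topology of the finite dimensional real vector space `InnerProducts W`. -/
noncomputable instance : TopologicalSpace (InnerProducts W) :=
  TopologicalSpace.induced (fun h => h.val) (inferInstance : TopologicalSpace (W → W → ℂ))

variable (W) in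
/-- The cone of positive definite inner products on `W`. -/
noncomputable def positiveDefinite : Set (InnerProducts W) := {h | ∀ s : W, s ≠ 0 → 0 < (h.val s s).re}

/-- `s` is orthonormal with respect to `h`. -/
def IsOrthonormal (h : InnerProducts W) {d : ℕ} (s : Fin d → W) : Prop :=
  ∀ i j, h.val (s i) (s j) = if i = j then 1 else 0

end InnerProducts

/-! ### The conjugate vector space and `W ⊗ W̄` -/

/-- The complex vector space `W̄` conjugate to `W`: the same additive group, with `c` acting as
multiplication by `conj c` does in `W`. -/
def Conj (W : Type*) : Type _ := W

section Conj

variable {W : Type*} [AddCommGroup W] [Module ℂ W]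

instance : AddCommGroup (Conj W) := inferInstanceAs (AddCommGroup W)

instance : Module ℂ (Conj W) := Module.compHom W (starRingEnd ℂ)

/-- The identity map `W → W̄`. -/
def toConj (w : W) : Conj W := w

/-- The linear form `η̄` on `W̄` conjugate to a linear form `η` on `W`. -/
noncomputable def conjForm (η : W →ₗ[ℂ] ℂ) : Conj W →ₗ[ℂ] ℂ where
  toFun w := conj (η (show W from w))
  map_add' a b := by
    have h : η (show W from a + b) = η (show W from a) + η (show W from b) := map_add η _ _
    rw [h, map_add]
  map_smul' c a := by
    have h : η (show W from c • a) = conj c * η (show W from a) := map_smul η (conj c) _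
    rw [h, map_mul, Complex.conj_conj]; rfl

/-- The linear form `ξ ⊗ η̄` on `W ⊗ W̄`. -/
noncomputable def tensorForm (ξ η : W →ₗ[ℂ] ℂ) : W ⊗[ℂ] Conj W →ₗ[ℂ] ℂ :=
  LinearMap.mul' ℂ ℂ ∘ₗ TensorProduct.map ξ (conjForm η)

@[simp] theorem tensorForm_tmul (ξ η : W →ₗ[ℂ] ℂ) (v w : W) :
    tensorForm ξ η (v ⊗ₜ[ℂ] toConj w) = ξ v * conj (η w) := rfl

end Conj

/-! ### Sections of `E` and of `E ⊗ Ē` -/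

section Bundles

variable (V : Type*) [NormedAddCommGroup V] [NormedSpace ℂ V]
  {X : Type*} [TopologicalSpace X] [ChartedSpace V X]
  (F : Type*) [NormedAddCommGroup F] [NormedSpace ℂ F]
  (E : X → Type*) [∀ x, AddCommGroup (E x)] [∀ x, Module ℂ (E x)]
  [∀ x, TopologicalSpace (E x)] [TopologicalSpace (TotalSpace F E)]
  [FiberBundle F E] [VectorBundle ℂ F E]

/-- The space `𝒪(E)` of holomorphic (that is, complex analytic) sections of `E → X`. -/
abbrev HolomorphicSections : Type _ := ContMDiffSection 𝓘(ℂ, V) F ω E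

/-- The open set in the model space `V` on which, in the coordinates given by the preferred chart
of `X` and the preferred trivialization of `E` at `x₀`, sections of `E` are represented. -/
def localDomain (x₀ : X) : Set V :=
  (chartAt V x₀).target ∩ (chartAt V x₀).symm ⁻¹' (trivializationAt F E x₀).baseSet

variable {F E} in
/-- The coefficient of a section `k` of `E ⊗ Ē` that belongs to the pair of linear forms `ξ, η` on
the model fiber: in the coordinates at `x₀`, the function `z ↦ (ξ ⊗ η̄) (k z)` on
`localDomain V F E x₀`. -/
noncomputable def localCoeff (x₀ : X) (ξ η : F →L[ℂ] ℂ) (k : ∀ x, E x ⊗[ℂ] Conj (E x)) (z : V) :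
    ℂ :=
  let x := (chartAt V x₀).symm z
  let e : E x →ₗ[ℂ] F := (trivializationAt F E x₀).linearMapAt ℂ x
  tensorForm ((ξ : F →ₗ[ℂ] ℂ) ∘ₗ e) ((η : F →ₗ[ℂ] ℂ) ∘ₗ e) (k x)

set_option linter.unusedSectionVars false in
variable {V} in
theorem localCoeff_add (x₀ : X) (ξ η : F →L[ℂ] ℂ) (k l : ∀ x, E x ⊗[ℂ] Conj (E x)) :
    localCoeff V x₀ ξ η (k + l) = localCoeff V x₀ ξ η k + localCoeff V x₀ ξ η l := by
  funext z; simp [localCoeff]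

set_option linter.unusedSectionVars false in
variable {V} in
theorem localCoeff_smul (x₀ : X) (ξ η : F →L[ℂ] ℂ) (c : ℂ) (k : ∀ x, E x ⊗[ℂ] Conj (E x)) :
    localCoeff V x₀ ξ η (c • k) = c • localCoeff V x₀ ξ η k := by
  funext z; simp [localCoeff]

/-- Smooth sections of `E ⊗ Ē`: those all of whose local coefficients are smooth functions, in the
sense of real differentiability. -/
def smoothSections : Submodule ℂ (∀ x, E x ⊗[ℂ] Conj (E x)) where
  carrier := {k | ∀ (x₀ : X) (ξ η : F →L[ℂ] ℂ),
    ContDiffOn ℝ ∞ (localCoeff V x₀ ξ η k) (localDomain V F E x₀)}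
  add_mem' {a b} ha hb x₀ ξ η := by
    rw [localCoeff_add]; exact (ha x₀ ξ η).add (hb x₀ ξ η)
  zero_mem' x₀ ξ η := by
    have : localCoeff V x₀ ξ η (0 : ∀ x, E x ⊗[ℂ] Conj (E x)) = fun _ => 0 := by
      funext z; simp [localCoeff]
    rw [this]; exact contDiffOn_const
  smul_mem' c a ha x₀ ξ η := by
    rw [localCoeff_smul]; exact (ha x₀ ξ η).const_smul c

/-- The space `C^∞(E ⊗ Ē)` of smooth sections. -/
def SmoothSections : Type _ := smoothSections V F E

noncomputable instance : AddCommGroup (SmoothSections V F E) :=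
  inferInstanceAs (AddCommGroup (smoothSections V F E))

noncomputable instance : Module ℂ (SmoothSections V F E) :=
  inferInstanceAs (Module ℂ (smoothSections V F E))

variable {V F E} in
/-- The value `k(x)` of a smooth section. -/
def SmoothSections.val (k : SmoothSections V F E) (x : X) : E x ⊗[ℂ] Conj (E x) := k.1 x

open scoped UniformConvergence in
/-- The `C^∞` topology: uniform convergence on compact sets of the derivatives of all orders of all
local coefficients. -/
noncomputable instance : TopologicalSpace (SmoothSections V F E) :=
  ⨅ (x₀ : X) (ξ : F →L[ℂ] ℂ) (η : F →L[ℂ] ℂ) (n : ℕ),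
    TopologicalSpace.induced
      (fun k => UniformOnFun.ofFun {K : Set V | IsCompact K ∧ K ⊆ localDomain V F E x₀}
        (iteratedFDeriv ℝ n (localCoeff V x₀ ξ η k.val)))
      inferInstance

variable {V F E}

/-- For a holomorphic section `s` the section `x ↦ s(x) ⊗ s(x)` of `E ⊗ Ē` is smooth. -/
theorem tmul_self_mem_smoothSections [IsManifold 𝓘(ℂ, V) ω X]
    [ContMDiffVectorBundle ω F E 𝓘(ℂ, V)] (s : HolomorphicSections V F E) :
    (fun x => s x ⊗ₜ[ℂ] toConj (s x)) ∈ smoothSections V F E := by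
  intro x₀ ξ η
  set e := trivializationAt F E x₀ with he
  have h1 : ContMDiffOn 𝓘(ℂ, V) 𝓘(ℂ, F) ω (fun x => (e ⟨x, s x⟩).2) e.baseSet :=
    (e.contMDiffOn_section_baseSet_iff (IB := 𝓘(ℂ, V)) (n := ω)).1 s.contMDiff.contMDiffOn
  have h2 : ContMDiffOn 𝓘(ℂ, V) 𝓘(ℂ, F) ω
      (fun z => (e ⟨(chartAt V x₀).symm z, s ((chartAt V x₀).symm z)⟩).2)
      (localDomain V F E x₀) :=
    h1.comp ((contMDiffOn_chart_symm (I := 𝓘(ℂ, V)) (n := ω) (x := x₀)).mono inter_subset_left)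
      (fun z hz => hz.2)
  have h3 : ContDiffOn ℝ ∞
      (fun z => (e ⟨(chartAt V x₀).symm z, s ((chartAt V x₀).symm z)⟩).2)
      (localDomain V F E x₀) := (h2.contDiffOn.restrict_scalars ℝ).of_le le_top
  have h4 (ξ : F →L[ℂ] ℂ) : ContDiffOn ℝ ∞
      (fun z => ξ (e ⟨(chartAt V x₀).symm z, s ((chartAt V x₀).symm z)⟩).2)
      (localDomain V F E x₀) := (ξ.restrictScalars ℝ).contDiff.comp_contDiffOn h3
  refine ((h4 ξ).mul (Complex.conjCLE.contDiff.comp_contDiffOn (h4 η))).congr ?_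
  intro z hz
  simp only [localCoeff, tensorForm_tmul, LinearMap.comp_apply]
  have hz' : (chartAt V x₀).symm z ∈ (trivializationAt F E x₀).baseSet := hz.2
  rw [Trivialization.linearMapAt_apply, if_pos hz']
  rfl

/-- The smooth section `x ↦ s(x) ⊗ s(x)` of `E ⊗ Ē`. -/
noncomputable def tmulSelf [IsManifold 𝓘(ℂ, V) ω X] [ContMDiffVectorBundle ω F E 𝓘(ℂ, V)]
    (s : HolomorphicSections V F E) : SmoothSections V F E :=
  ⟨fun x => s x ⊗ₜ[ℂ] toConj (s x), tmul_self_mem_smoothSections s⟩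

open scoped Classical in
/-- The map `b`: the Bergman section `∑ⱼ sⱼ ⊗ sⱼ` of an inner product `h` on `𝒪(E)`, where
`s₁, …, s_d` is a basis of `𝒪(E)`, orthonormal with respect to `h`. If there is no such
basis (and `h` is not positive definite), the value is `0`. -/
noncomputable def bergmanSection [IsManifold 𝓘(ℂ, V) ω X] [ContMDiffVectorBundle ω F E 𝓘(ℂ, V)]
    (h : InnerProducts (HolomorphicSections V F E)) : SmoothSections V F E :=
  if hs : ∃ (d : ℕ) (s : Module.Basis (Fin d) ℂ (HolomorphicSections V F E)), IsOrthonormal h s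
  then ∑ j, tmulSelf (hs.choose_spec.choose j)
  else 0

end Bundles

end Bergman

namespace Bergman

/-! ### Differential calculus in locally convex spaces -/

set_option linter.unusedSectionVars false

section Calculus

section Basic

variable {G : Type*} [AddCommGroup G] [Module ℝ G] [TopologicalSpace G]

/-! Fix a basis `w` of 𝒪(E). If an orthonormal basis of an inner product h is written as s_j = ∑
B_ij w_i, then ∑ s_j ⊗ s_j = ∑ (B B*)_ik w_i ⊗ w_k, and B B* is the transposed inverse of the Gram
matrix of h (`InnerProducts.invTranspose_gram_eq`). Hence b = τ ∘ σ on the cone. Here σ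
(`InnerProducts.dual`) replaces the Gram matrix by its transposed inverse and is a smooth involution
of the cone. The map τ (`gramSection`) is real linear and sends h to the section ∑ h_ij w_i ⊗ w_j.

The map τ is injective by polarization. A relation ∑ a_ij w_i ⊗ w_j = 0 on the diagonal extends to
pairs of points (z, z'), holomorphically in z and antiholomorphically in z', and linear independence
of the w_i then gives a = 0 (`eq_zero_of_sum_tmulSection_eq_zero`). As its source is finite
dimensional, τ has a continuous linear left inverse l by Hahn–Banach. The image of b is therefore an
open piece of a closed finite dimensional subspace: translations are adapted charts, and σ ∘ l
inverts b. Since the diffeomorphism property is tested in arbitrary adapted charts, a chain rule for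
Hamilton's C^k maps is needed; it rests on a mean value theorem.

Two facts remain: smooth sections form a Fréchet space, and 𝒪(E) is finite dimensional. Both use one
estimate, `BallCover.exists_norm_iteratedFDeriv_localCoeff_le`: finitely many coefficients on
finitely many coordinate balls control all coefficients in all coordinates. It embeds the space of
smooth sections in a countable product of Banach spaces. Combined with the Schwarz lemma, it shows
that evaluation at a suitable finite set of points is injective on 𝒪(E). -/

theorem IsCk.mono {k : ℕ} : ∀ {F : Type*} [AddCommGroup F] [Module ℝ F] [TopologicalSpace F]
    {f : F → G} {U U' : Set F}, IsCk k f U → U' ⊆ U → IsCk k f U' := by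
  induction k with
  | zero => intro F _ _ _ f U U' h hU; exact ContinuousOn.mono h hU
  | succ k ih =>
    rintro F _ _ _ f U U' ⟨df, h1, h2⟩ hU
    exact ⟨df, fun x hx => h1 x (hU hx), ih h2 (prod_mono hU Subset.rfl)⟩

theorem eventually_add_smul_mem {F : Type*} [AddCommGroup F] [Module ℝ F] [TopologicalSpace F]
    [ContinuousAdd F] [ContinuousSMul ℝ F] {U : Set F} (hU : IsOpen U) {x : F} (hx : x ∈ U)
    (ξ : F) : ∀ᶠ t : ℝ in 𝓝[≠] 0, x + t • ξ ∈ U := by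
  have h : Tendsto (fun t : ℝ => x + t • ξ) (𝓝 0) (𝓝 x) := by
    have : Continuous (fun t : ℝ => x + t • ξ) := by fun_prop
    simpa using this.tendsto 0
  exact nhdsWithin_le_nhds (h.eventually (hU.mem_nhds hx))

theorem IsCk.congr {k : ℕ} {F : Type*} [AddCommGroup F] [Module ℝ F] [TopologicalSpace F]
    [ContinuousAdd F] [ContinuousSMul ℝ F] {f g : F → G} {U : Set F} (hU : IsOpen U)
    (h : IsCk k f U) (hfg : EqOn f g U) : IsCk k g U := by
  cases k with
  | zero => exact ContinuousOn.congr h hfg.symm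
  | succ k =>
    obtain ⟨df, h1, h2⟩ := h
    refine ⟨df, fun x hx ξ => (h1 x hx ξ).congr' ?_, h2⟩
    filter_upwards [eventually_add_smul_mem hU hx ξ] with t ht
    rw [hfg ht, hfg hx]

theorem IsCk.continuousLinearMap {k : ℕ} : ∀ {F : Type*} [AddCommGroup F] [Module ℝ F]
    [TopologicalSpace F] (L : F →L[ℝ] G) (U : Set F), IsCk k L U := by
  induction k with
  | zero => intro F _ _ _ L U; exact L.continuous.continuousOn
  | succ k ih =>
    intro F _ _ _ L U
    refine ⟨fun p => L p.2, fun x hx ξ => ?_,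
      ih (L.comp (ContinuousLinearMap.snd ℝ F F)) (U ×ˢ univ)⟩
    refine tendsto_const_nhds.congr' ?_
    filter_upwards [self_mem_nhdsWithin] with t (ht : t ≠ 0)
    simp [smul_smul, ht]

theorem IsCk.comp_continuousLinearMap {k : ℕ} : ∀ {E F : Type*} [AddCommGroup E] [Module ℝ E]
    [TopologicalSpace E] [AddCommGroup F] [Module ℝ F] [TopologicalSpace F]
    {f : F → G} {U : Set F} (L : E →L[ℝ] F), IsCk k f U → IsCk k (f ∘ L) (L ⁻¹' U) := by
  induction k with
  | zero =>
    intro E F _ _ _ _ _ _ f U L h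
    exact ContinuousOn.comp h L.continuous.continuousOn (fun x hx => hx)
  | succ k ih =>
    rintro E F _ _ _ _ _ _ f U L ⟨df, h1, h2⟩
    refine ⟨df ∘ (L.prodMap L), fun x hx ξ => ?_, ?_⟩
    · simpa using h1 (L x) hx (L ξ)
    · have := ih (L.prodMap L) h2
      refine this.mono ?_
      rintro ⟨a, b⟩ ⟨ha, -⟩
      exact ⟨ha, trivial⟩

theorem IsCk.prodMk {k : ℕ} {H : Type*} [AddCommGroup H] [Module ℝ H] [TopologicalSpace H] :
    ∀ {F : Type*} [AddCommGroup F] [Module ℝ F] [TopologicalSpace F]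
    {f : F → G} {g : F → H} {U : Set F}, IsCk k f U → IsCk k g U →
      IsCk k (fun x => (f x, g x)) U := by
  induction k with
  | zero => intro F _ _ _ f g U hf hg; exact ContinuousOn.prodMk hf hg
  | succ k ih =>
    rintro F _ _ _ f g U ⟨df, f1, f2⟩ ⟨dg, g1, g2⟩
    exact ⟨fun p => (df p, dg p), fun x hx ξ => (f1 x hx ξ).prodMk_nhds (g1 x hx ξ), ih f2 g2⟩

theorem IsCk.add_const {k : ℕ} [ContinuousAdd G] {F : Type*} [AddCommGroup F] [Module ℝ F]
    [TopologicalSpace F] {f : F → G} {U : Set F} (h : IsCk k f U) (c : G) :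
    IsCk k (fun x => f x + c) U := by
  cases k with
  | zero => exact ContinuousOn.add h continuousOn_const
  | succ k =>
    obtain ⟨df, h1, h2⟩ := h
    refine ⟨df, fun x hx ξ => ?_, h2⟩
    simpa using h1 x hx ξ

/-- A `C^k` map with values in a closed subspace is `C^k` as a map to that subspace. -/
theorem IsCk.codRestrict {k : ℕ} {S : Submodule ℝ G} (hS : IsClosed (S : Set G)) :
    ∀ {F : Type*} [AddCommGroup F] [Module ℝ F] [TopologicalSpace F]
    [ContinuousAdd F] [ContinuousSMul ℝ F] {f : F → G} {g : F → S} {U : Set F}, IsOpen U →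
    IsCk k f U → (∀ x ∈ U, (g x : G) = f x) → IsCk k g U := by
  classical
  induction k with
  | zero =>
    intro F _ _ _ _ _ f g U hU hf hg
    exact (Topology.IsInducing.subtypeVal.continuousOn_iff).2 (ContinuousOn.congr hf hg)
  | succ k ih =>
    rintro F _ _ _ _ _ f g U hU ⟨df, f1, f2⟩ hg
    have key : ∀ x ∈ U, ∀ ξ : F, Tendsto (fun t : ℝ => ((t⁻¹ • (g (x + t • ξ) - g x) : S) : G))
        (𝓝[≠] 0) (𝓝 (df (x, ξ))) := by
      intro x hx ξ
      refine (f1 x hx ξ).congr' ?_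
      filter_upwards [eventually_add_smul_mem hU hx ξ] with t ht
      simp [hg _ ht, hg x hx]
    -- Closedness of `S` is used here: derivatives are limits of difference quotients lying in `S`.
    -- Outside `U ×ˢ univ` the differential may leave `S`, hence the default value 0 below.
    have hmem : ∀ p ∈ U ×ˢ (univ : Set F), df p ∈ S := by
      rintro ⟨x, ξ⟩ ⟨hx, -⟩
      exact hS.mem_of_tendsto (key x hx ξ) (Eventually.of_forall fun t => Subtype.mem _)
    refine ⟨fun p => if h : df p ∈ S then ⟨df p, h⟩ else 0, fun x hx ξ => ?_, ?_⟩
    · rw [tendsto_subtype_rng]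
      simpa only [dif_pos (hmem (x, ξ) ⟨hx, trivial⟩)] using key x hx ξ
    · refine ih (hU.prod isOpen_univ) f2 fun p hp => ?_
      rw [dif_pos (hmem p hp)]

end Basic

/-! ### Mean value estimates and the chain rule along curves -/

section MeanValue

variable {E : Type*} [AddCommGroup E] [Module ℝ E] [TopologicalSpace E]
  [IsTopologicalAddGroup E] [ContinuousSMul ℝ E]
  {G : Type*} [AddCommGroup G] [Module ℝ G] [TopologicalSpace G]
  [IsTopologicalAddGroup G] [ContinuousSMul ℝ G] [LocallyConvexSpace ℝ G]

/-- The mean value theorem for curves in a locally convex space. -/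
theorem sub_mem_of_curve_deriv_mem {γ γ' : ℝ → G} {C : Set G} (hC : Convex ℝ C)
    (hC' : IsClosed C)
    (hγ : ∀ s ∈ Icc (0 : ℝ) 1,
      Tendsto (fun t : ℝ => t⁻¹ • (γ (s + t) - γ s)) (𝓝[≠] 0) (𝓝 (γ' s)))
    (hmem : ∀ s ∈ Icc (0 : ℝ) 1, γ' s ∈ C) : γ 1 - γ 0 ∈ C := by
  by_contra hn
  -- A functional separating the increment from `C` reduces the claim to the classical mean value
  -- theorem for a real function.
  obtain ⟨l, u, h1, h2⟩ := geometric_hahn_banach_closed_point hC hC' hn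
  have hd : ∀ s ∈ Icc (0 : ℝ) 1, HasDerivAt (fun s => l (γ s)) (l (γ' s)) s := by
    intro s hs
    rw [hasDerivAt_iff_tendsto_slope_zero]
    refine ((l.continuous.tendsto _).comp (hγ s hs)).congr fun t => ?_
    simp
  obtain ⟨c, hc, hc'⟩ := exists_hasDerivAt_eq_slope (fun s => l (γ s)) (fun s => l (γ' s))
    one_pos (fun s hs => (hd s hs).continuousAt.continuousWithinAt)
    (fun s hs => hd s (Ioo_subset_Icc_self hs))
  have := h1 _ (hmem c (Ioo_subset_Icc_self hc))
  simp at hc'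
  rw [map_sub] at h2
  linarith

/-- `df` is the directional derivative of `f` on `U`. -/
def HasDirDerivOn (f : E → G) (df : E × E → G) (U : Set E) : Prop :=
  ∀ x ∈ U, ∀ ξ : E,
    Tendsto (fun t : ℝ => t⁻¹ • (f (x + t • ξ) - f x)) (𝓝[≠] 0) (𝓝 (df (x, ξ)))

/-- Reparametrization t ↦ tc of the difference quotient. Homogeneity is all the linearity of the
differential that the mean value estimates require. -/
theorem HasDirDerivOn.map_smul [T2Space G] {f : E → G} {df : E × E → G} {U : Set E}
    (h : HasDirDerivOn f df U)
    {x : E} (hx : x ∈ U) (c : ℝ) (ξ : E) : df (x, c • ξ) = c • df (x, ξ) := by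
  rcases eq_or_ne c 0 with rfl | hc
  · refine tendsto_nhds_unique (h x hx _) ?_
    simp
  · refine tendsto_nhds_unique (h x hx _) ?_
    have hct : Tendsto (fun t : ℝ => t * c) (𝓝[≠] 0) (𝓝[≠] 0) := by
      refine tendsto_nhdsWithin_iff.2 ⟨?_, ?_⟩
      · have : Tendsto (fun t : ℝ => t * c) (𝓝 0) (𝓝 (0 * c)) := by
          exact (continuous_mul_const c).tendsto 0
        rw [zero_mul] at this
        exact this.mono_left nhdsWithin_le_nhds
      · filter_upwards [self_mem_nhdsWithin] with t (ht : t ≠ 0)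
        exact mul_ne_zero ht hc
    refine (((h x hx ξ).comp hct).const_smul c).congr fun t => ?_
    simp [smul_smul, hc]

/-- The mean value theorem on the segment from x to x + cξ. By homogeneity, dividing by c turns the
derivative along the segment into the derivative in the direction ξ, so the set `C` does not depend
on c. -/
theorem HasDirDerivOn.sub_mem [T2Space G] {f : E → G} {df : E × E → G} {U : Set E}
    (h : HasDirDerivOn f df U) {C : Set G} (hC : Convex ℝ C) (hC' : IsClosed C) {x ξ : E} (c : ℝ)
    (hU : ∀ s ∈ Icc (0 : ℝ) 1, x + s • c • ξ ∈ U)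
    (hm : ∀ s ∈ Icc (0 : ℝ) 1, df (x + s • c • ξ, ξ) ∈ C) (hc : c ≠ 0) :
    c⁻¹ • (f (x + c • ξ) - f x) ∈ C := by
  have := sub_mem_of_curve_deriv_mem (γ := fun s => c⁻¹ • f (x + s • c • ξ))
    (γ' := fun s => df (x + s • c • ξ, ξ)) hC hC' (fun s hs => ?_) hm
  · simpa [smul_sub] using this
  · have h1 := (h _ (hU s hs) (c • ξ)).const_smul c⁻¹
    rw [h.map_smul (hU s hs), inv_smul_smul₀ hc] at h1
    refine h1.congr fun t => ?_
    rw [add_smul, ← add_assoc, smul_comm, smul_sub]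

/-- A tube argument over the compact interval: for displacement 0 the whole segment is the point x,
where both conditions hold in a neighbourhood. The displacement and the direction vary
independently, as the chain rule requires. -/
theorem eventually_segment {df : E × E → G} {U : Set E} (hU : IsOpen U)
    (hdf : ContinuousOn df (U ×ˢ univ)) {x : E} (hx : x ∈ U) (ξ : E) {C : Set G}
    (hC : C ∈ 𝓝 (df (x, ξ))) :
    ∀ᶠ q : E × E in 𝓝 (0, ξ), ∀ s ∈ Icc (0 : ℝ) 1,
      x + s • q.1 ∈ U ∧ df (x + s • q.1, q.2) ∈ C := by
  refine isCompact_Icc.eventually_forall_of_forall_eventually fun s hs => ?_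
  have hc : Continuous fun z : (E × E) × ℝ => (x + z.2 • z.1.1, z.1.2) := by fun_prop
  have ht : Tendsto (fun z : (E × E) × ℝ => (x + z.2 • z.1.1, z.1.2)) (𝓝 ((0, ξ), s))
      (𝓝 (x, ξ)) := by
    have := hc.tendsto ((0, ξ), s)
    simpa using this
  have h1 : ∀ᶠ p in 𝓝 (x, ξ), p.1 ∈ U ∧ df p ∈ C := by
    refine Filter.Eventually.and ?_ ?_
    · exact continuous_fst.continuousAt.eventually (hU.mem_nhds hx)
    · exact (hdf.continuousAt ((hU.prod isOpen_univ).mem_nhds ⟨hx, trivial⟩)).eventually hC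
  exact ht.eventually h1

theorem exists_closed_convex_nhds {y : G} {N : Set G}
    (hN : N ∈ 𝓝 y) : ∃ C ∈ 𝓝 y, Convex ℝ C ∧ IsClosed C ∧ C ⊆ N := by
  obtain ⟨N', ⟨h1, h2⟩, h3⟩ := (closed_nhds_basis y).mem_iff.1 hN
  obtain ⟨C, ⟨h4, h5⟩, h6⟩ := ((LocallyConvexSpace.convex_basis (𝕜 := ℝ) y)).mem_iff.1 h1
  exact ⟨closure C, mem_of_superset h4 subset_closure, h5.closure, isClosed_closure,
    (closure_minimal h6 h2).trans h3⟩

/-- The chain rule along curves. -/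
theorem HasDirDerivOn.tendsto_curve [T2Space G] {f : E → G} {df : E × E → G} {U : Set E}
    (hU : IsOpen U) (h : HasDirDerivOn f df U) (hdf : ContinuousOn df (U ×ˢ univ))
    {x : E} (hx : x ∈ U) {ξ : E} {c : ℝ → E}
    (hc : Tendsto (fun t : ℝ => t⁻¹ • (c t - x)) (𝓝[≠] 0) (𝓝 ξ)) :
    Tendsto (fun t : ℝ => t⁻¹ • (f (c t) - f x)) (𝓝[≠] 0) (𝓝 (df (x, ξ))) := by
  intro N hN
  obtain ⟨C, hC, hC1, hC2, hCN⟩ := exists_closed_convex_nhds hN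
  -- The displacement c(t) - x is t times the difference quotient. It tends to 0 while the quotient
  -- tends to ξ, so the mean value estimate applies with the varying quotient as direction.
  have h0 : Tendsto (fun t : ℝ => t • (t⁻¹ • (c t - x))) (𝓝[≠] 0) (𝓝 0) := by
    have : Tendsto (fun t : ℝ => t) (𝓝[≠] 0) (𝓝 0) := nhdsWithin_le_nhds
    simpa using this.smul hc
  have := (h0.prodMk_nhds hc).eventually (eventually_segment hU hdf hx ξ hC)
  rw [mem_map]
  filter_upwards [this, self_mem_nhdsWithin] with t ht (ht0 : t ≠ 0)
  refine hCN ?_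
  have := h.sub_mem hC1 hC2 t (fun s hs => (ht s hs).1) (fun s hs => (ht s hs).2) ht0
  simpa [smul_smul, ht0] using this

/-- Taking y - x both as displacement and as direction places f(y) - f(x) in any given closed convex
neighbourhood of df(x, 0) = 0. -/
theorem HasDirDerivOn.continuousOn [T2Space G] {f : E → G} {df : E × E → G} {U : Set E}
    (hU : IsOpen U) (h : HasDirDerivOn f df U) (hdf : ContinuousOn df (U ×ˢ univ)) :
    ContinuousOn f U := by
  intro x hx
  refine ContinuousAt.continuousWithinAt ?_
  have h00 : df (x, 0) = 0 := by simpa using h.map_smul hx 0 0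
  suffices Tendsto (fun y => f y - f x) (𝓝 x) (𝓝 0) by
    simpa [ContinuousAt] using this.add_const (f x)
  intro N hN
  rw [← h00] at hN
  obtain ⟨C, hC, hC1, hC2, hCN⟩ := exists_closed_convex_nhds hN
  have h0 : Tendsto (fun y : E => y - x) (𝓝 x) (𝓝 0) := by
    have hc : Continuous fun y : E => y - x := by fun_prop
    simpa using hc.tendsto x
  have := (h0.prodMk_nhds h0).eventually (eventually_segment hU hdf hx 0 hC)
  rw [mem_map]
  filter_upwards [this] with y hy
  refine hCN ?_
  have := h.sub_mem hC1 hC2 (x := x) (ξ := y - x) 1 (fun s hs => by simpa using (hy s hs).1)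
    (fun s hs => by simpa using (hy s hs).2) one_ne_zero
  simpa using this

end MeanValue

/-! ### Composition of maps of class C^k -/

section ChainRule

universe u₁ u₂ u₃

variable {G : Type u₃} [AddCommGroup G] [Module ℝ G] [TopologicalSpace G]
  [IsTopologicalAddGroup G] [ContinuousSMul ℝ G] [LocallyConvexSpace ℝ G] [T2Space G]

/-- Continuity is not part of the definition of class C^(k+1). It comes from the mean value theorem
for k = 0, and the induction then runs on the differential. -/
theorem IsCk.of_succ {k : ℕ} : ∀ {E : Type u₁} [AddCommGroup E] [Module ℝ E] [TopologicalSpace E]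
    [IsTopologicalAddGroup E] [ContinuousSMul ℝ E] {f : E → G} {U : Set E}, IsOpen U →
    IsCk (k + 1) f U → IsCk k f U := by
  induction k with
  | zero =>
    rintro E _ _ _ _ _ f U hU ⟨df, h1, h2⟩
    exact HasDirDerivOn.continuousOn hU h1 h2
  | succ k ih =>
    rintro E _ _ _ _ _ f U hU ⟨df, h1, h2⟩
    exact ⟨df, h1, ih (hU.prod isOpen_univ) h2⟩

theorem IsCk.continuousOn {k : ℕ} {E : Type u₁} [AddCommGroup E] [Module ℝ E] [TopologicalSpace E]
    [IsTopologicalAddGroup E] [ContinuousSMul ℝ E] {f : E → G} {U : Set E} (hU : IsOpen U)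
    (h : IsCk k f U) : ContinuousOn f U := by
  induction k with
  | zero => exact h
  | succ k ih => exact ih (h.of_succ hU)

/-- Compositions of `C^k` maps are of class `C^k`. -/
theorem IsCk.comp {k : ℕ} : ∀ {E : Type u₁} [AddCommGroup E] [Module ℝ E] [TopologicalSpace E]
    [IsTopologicalAddGroup E] [ContinuousSMul ℝ E]
    {F : Type u₂} [AddCommGroup F] [Module ℝ F] [TopologicalSpace F]
    [IsTopologicalAddGroup F] [ContinuousSMul ℝ F] [LocallyConvexSpace ℝ F] [T2Space F]
    {f : E → F} {g : F → G} {U : Set E} {V : Set F}, IsOpen U → IsOpen V →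
    IsCk k g V → IsCk k f U → MapsTo f U V → IsCk k (g ∘ f) U := by
  induction k with
  | zero =>
    intro E _ _ _ _ _ F _ _ _ _ _ _ _ f g U V hU hV hg hf hm
    exact ContinuousOn.comp hg hf hm
  | succ k ih =>
    intro E _ _ _ _ _ F _ _ _ _ _ _ _ f g U V hU hV hg hf hm
    have hfk : IsCk k f U := hf.of_succ hU
    obtain ⟨df, f1, f2⟩ := hf
    obtain ⟨dg, g1, g2⟩ := hg
    -- The differential of the composition is again a composition of two C^k maps, so the induction
    -- must quantify over all source and intermediate spaces.
    refine ⟨dg ∘ fun p => (f p.1, df p), fun x hx ξ => ?_, ?_⟩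
    · exact HasDirDerivOn.tendsto_curve hV g1 (g2.continuousOn (hV.prod isOpen_univ)) (hm hx)
        (f1 x hx ξ)
    · refine ih (hU.prod isOpen_univ) (hV.prod isOpen_univ) g2 ?_
        (fun p hp => ⟨hm hp.1, trivial⟩)
      refine IsCk.prodMk ?_ f2
      exact (hfk.comp_continuousLinearMap (ContinuousLinearMap.fst ℝ E E)).mono
        fun p hp => hp.1

end ChainRule

theorem _root_.ContDiffOn.isCk {G : Type*} [NormedAddCommGroup G] [NormedSpace ℝ G] {k : ℕ} :
    ∀ {E : Type*} [NormedAddCommGroup E] [NormedSpace ℝ E] {f : E → G} {U : Set E},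
    IsOpen U → ContDiffOn ℝ ∞ f U → IsCk k f U := by
  induction k with
  | zero => intro E _ _ f U hU h; exact h.continuousOn
  | succ k ih =>
    intro E _ _ f U hU h
    refine ⟨fun p => fderiv ℝ f p.1 p.2, fun x hx ξ => ?_, ?_⟩
    · have hd : HasFDerivAt f (fderiv ℝ f x) x :=
        ((h.contDiffAt (hU.mem_nhds hx)).differentiableAt (by simp)).hasFDerivAt
      exact (hd.hasLineDerivAt ξ).tendsto_slope_zero
    · refine ih (hU.prod isOpen_univ) ?_
      have h1 : ContDiffOn ℝ ∞ (fderiv ℝ f) U := h.fderiv_of_isOpen hU (by simp)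
      exact (h1.comp contDiff_fst.contDiffOn fun p hp => hp.1).clm_apply contDiff_snd.contDiffOn

end Calculus

/-! ### Iterated derivatives: bounds and limits -/

section IteratedDerivatives

variable {V : Type*} [NormedAddCommGroup V] [NormedSpace ℝ V]

theorem eventually_norm_iteratedFDerivWithin_le {Y : Type*} [NormedAddCommGroup Y]
    [NormedSpace ℝ Y] {D : Set V} (hD : IsOpen D) {f : V → Y} (hf : ContDiffOn ℝ ∞ f D) (n : ℕ)
    {z₀ : V} (hz₀ : z₀ ∈ D) :
    ∀ᶠ z in 𝓝 z₀, ∀ i ∈ Finset.range (n + 1),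
      ‖iteratedFDerivWithin ℝ i f D z‖ ≤ ‖iteratedFDerivWithin ℝ i f D z₀‖ + 1 := by
  refine (Finset.eventually_all _).2 fun i _ => ?_
  have hcont : ContinuousOn (iteratedFDerivWithin ℝ i f D) D :=
    hf.continuousOn_iteratedFDerivWithin (by exact_mod_cast le_top) hD.uniqueDiffOn
  have := (hcont.continuousAt (hD.mem_nhds hz₀)).norm
  filter_upwards [this.eventually (gt_mem_nhds (lt_add_one _))] with z hz using hz.le

/-- The Leibniz rule together with the Faà di Bruno bound. The point is uniformity: neither the
constant nor the neighbourhood of z₀ depends on g. -/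
theorem exists_norm_iteratedFDeriv_comp_mul_le {V' : Type*} [NormedAddCommGroup V']
    [NormedSpace ℝ V'] {D : Set V} {Ω : Set V'} (hD : IsOpen D) (hΩ : IsOpen Ω)
    {φ : V → V'} {c : V → ℂ} (hφ : ContDiffOn ℝ ∞ φ D) (hc : ContDiffOn ℝ ∞ c D)
    (hm : MapsTo φ D Ω) (n : ℕ) {z₀ : V} (hz₀ : z₀ ∈ D) :
    ∃ C : ℝ, 0 ≤ C ∧ ∀ᶠ z in 𝓝 z₀, ∀ g : V' → ℂ, ContDiffOn ℝ ∞ g Ω → ∀ B : ℝ,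
      (∀ m ≤ n, ‖iteratedFDeriv ℝ m g (φ z)‖ ≤ B) →
      ‖iteratedFDeriv ℝ n (fun z => g (φ z) * c z) z‖ ≤ C * B := by
  -- The bound for compositions asks for D^m on the m-th derivative of φ. The summand 1 makes D ≤
  -- D^m for m ≥ 1, so a bound by D itself suffices.
  set Dφ : ℝ := 1 + ∑ i ∈ Finset.range (n + 1), (‖iteratedFDerivWithin ℝ i φ D z₀‖ + 1) with hDφ
  set A : ℝ := ∑ i ∈ Finset.range (n + 1), (‖iteratedFDerivWithin ℝ i c D z₀‖ + 1) with hA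
  have hDφ1 : 1 ≤ Dφ := by
    rw [hDφ]; exact le_add_of_nonneg_right (Finset.sum_nonneg fun i _ => by positivity)
  have hA0 : 0 ≤ A := Finset.sum_nonneg fun i _ => by positivity
  refine ⟨∑ i ∈ Finset.range (n + 1), (n.choose i : ℝ) * (i.factorial * Dφ ^ i) * A,
    Finset.sum_nonneg fun i _ => by positivity, ?_⟩
  filter_upwards [eventually_norm_iteratedFDerivWithin_le hD hφ n hz₀,
    eventually_norm_iteratedFDerivWithin_le hD hc n hz₀, hD.mem_nhds hz₀] with z hz1 hz2 hzD g hg B hB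
  rw [← iteratedFDerivWithin_of_isOpen n hD hzD]
  refine (norm_iteratedFDerivWithin_mul_le (N := ∞) (f := g ∘ φ) (hg.comp hφ hm) hc
    hD.uniqueDiffOn hzD (by exact_mod_cast le_top)).trans ?_
  rw [Finset.sum_mul]
  refine Finset.sum_le_sum fun i hi => ?_
  have hin : i ≤ n := Nat.lt_succ_iff.1 (Finset.mem_range.1 hi)
  have h1 : ‖iteratedFDerivWithin ℝ i (g ∘ φ) D z‖ ≤ i.factorial * B * Dφ ^ i := by
    refine norm_iteratedFDerivWithin_comp_le (N := ∞) hg hφ (by exact_mod_cast le_top)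
      hΩ.uniqueDiffOn hD.uniqueDiffOn hm hzD (fun m hm' => ?_) (fun m hm1 hmi => ?_)
    · rw [iteratedFDerivWithin_of_isOpen m hΩ (hm hzD)]
      exact hB m (hm'.trans hin)
    · have hmr : m ∈ Finset.range (n + 1) := Finset.mem_range.2 (by omega)
      refine (hz1 m hmr).trans (le_trans ?_ (le_self_pow₀ hDφ1 (by omega)))
      rw [hDφ]
      refine le_trans ?_ (le_add_of_nonneg_left zero_le_one)
      exact Finset.single_le_sum
        (f := fun i => ‖iteratedFDerivWithin ℝ i φ D z₀‖ + 1) (fun i _ => by positivity) hmr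
  have h2 : ‖iteratedFDerivWithin ℝ (n - i) c D z‖ ≤ A := by
    have hmr : n - i ∈ Finset.range (n + 1) := Finset.mem_range.2 (by omega)
    exact (hz2 _ hmr).trans (Finset.single_le_sum
      (f := fun i => ‖iteratedFDerivWithin ℝ i c D z₀‖ + 1) (fun i _ => by positivity) hmr)
  have hB0 : 0 ≤ B := (norm_nonneg _).trans (hB 0 (Nat.zero_le _))
  calc (n.choose i : ℝ) * ‖iteratedFDerivWithin ℝ i (g ∘ φ) D z‖ *
        ‖iteratedFDerivWithin ℝ (n - i) c D z‖
      ≤ (n.choose i : ℝ) * (i.factorial * B * Dφ ^ i) * A := by gcongr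
    _ = _ := by ring

/-- A limit of smooth functions all of whose derivatives converge locally uniformly is smooth, and
its derivatives are the limits of the derivatives. -/
theorem contDiffOn_of_tendstoLocallyUniformlyOn_iteratedFDeriv {ι : Type*} {l : Filter ι} [l.NeBot]
    {Y : Type*} [NormedAddCommGroup Y] [NormedSpace ℝ Y]
    {Ω : Set V} (hΩ : IsOpen Ω) {f : ι → V → Y} (hf : ∀ j, ContDiffOn ℝ ∞ (f j) Ω)
    {g : ∀ n : ℕ, V → V [×n]→L[ℝ] Y}
    (hg : ∀ n, TendstoLocallyUniformlyOn (fun j => iteratedFDeriv ℝ n (f j)) (g n) l Ω)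
    {h : V → Y} (hh : ∀ z ∈ Ω, Tendsto (fun j => f j z) l (𝓝 (h z))) :
    ContDiffOn ℝ ∞ h Ω ∧ ∀ n, EqOn (iteratedFDeriv ℝ n h) (g n) Ω := by
  -- Termwise differentiation at every order: the derivative of the n-th derivative is the curried
  -- derivative of order n + 1, whose limit is `g (n + 1)`.
  have hderiv : ∀ n, ∀ z ∈ Ω, HasFDerivAt (g n)
      (continuousMultilinearCurryLeftEquiv ℝ (fun _ : Fin (n + 1) => V) Y (g (n + 1) z)) z := by
    intro n z hz
    refine hasFDerivAt_of_tendstoLocallyUniformlyOn (l := l) hΩ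
      (f := fun j => iteratedFDeriv ℝ n (f j))
      (f' := fun j z => continuousMultilinearCurryLeftEquiv ℝ (fun _ : Fin (n + 1) => V) Y
        (iteratedFDeriv ℝ (n + 1) (f j) z))
      (g' := fun z => continuousMultilinearCurryLeftEquiv ℝ (fun _ : Fin (n + 1) => V) Y
        (g (n + 1) z)) ?_ ?_ ?_ hz
    · exact (continuousMultilinearCurryLeftEquiv ℝ (fun _ : Fin (n + 1) => V)
        Y).isometry.uniformContinuous.comp_tendstoLocallyUniformlyOn (hg (n + 1))
    · intro j x hx
      have hd : DifferentiableAt ℝ (iteratedFDeriv ℝ n (f j)) x :=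
        ((hf j).contDiffAt (hΩ.mem_nhds hx)).differentiableAt_iteratedFDeriv
          (by exact_mod_cast WithTop.coe_lt_top _)
      rw [iteratedFDeriv_succ_eq_comp_left]
      simpa using hd.hasFDerivAt
    · exact fun x hx => (hg n).tendsto_at hx
  have heq : ∀ n, EqOn (iteratedFDeriv ℝ n h) (g n) Ω := by
    intro n
    induction n with
    | zero =>
      intro z hz
      refine tendsto_nhds_unique ?_ ((hg 0).tendsto_at hz)
      simp only [iteratedFDeriv_zero_eq_comp, Function.comp_apply]
      exact ((continuousMultilinearCurryFin0 ℝ V Y).symm.continuous.tendsto _).comp (hh z hz)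
    | succ n ih =>
      intro z hz
      rw [iteratedFDeriv_succ_eq_comp_left, Function.comp_apply]
      have h1 : iteratedFDeriv ℝ n h =ᶠ[𝓝 z] g n := ih.eventuallyEq_of_mem (hΩ.mem_nhds hz)
      rw [h1.fderiv_eq, (hderiv n z hz).fderiv]
      exact LinearIsometryEquiv.symm_apply_apply _ _
  refine ⟨contDiffOn_of_differentiableOn fun m _ => ?_, heq⟩
  intro z hz
  have h1 : iteratedFDerivWithin ℝ m h Ω =ᶠ[𝓝 z] g m :=
    ((iteratedFDerivWithin_of_isOpen m hΩ).trans (heq m)).eventuallyEq_of_mem (hΩ.mem_nhds hz)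
  exact (h1.differentiableAt_iff.2 (hderiv m z hz).differentiableAt).differentiableWithinAt

end IteratedDerivatives

/-! ### Linear forms on `W ⊗ W̄` -/

section TensorForms

variable {W : Type*} [AddCommGroup W] [Module ℂ W]

theorem toConj_add (v w : W) : toConj (v + w) = toConj v + toConj w := rfl

theorem toConj_smul (c : ℂ) (w : W) : toConj (c • w) = conj c • toConj w := by
  change c • w = conj (conj c) • w
  rw [Complex.conj_conj]

theorem toConj_sum {ι : Type*} (s : Finset ι) (f : ι → W) :
    toConj (∑ i ∈ s, f i) = ∑ i ∈ s, toConj (f i) := by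
  induction s using Finset.cons_induction with
  | empty => rfl
  | cons a s ha ih => rw [Finset.sum_cons, Finset.sum_cons, toConj_add, ih]

/-- The forms attached to pairs of coordinate forms are the coordinates for the tensors b_i ⊗ b̄_j.
By additivity only pure tensors need checking. -/
theorem eq_sum_tensorForm_smul {ι : Type*} [Fintype ι] (b : Module.Basis ι ℂ W)
    (t : W ⊗[ℂ] Conj W) :
    t = ∑ i, ∑ j, tensorForm (b.coord i) (b.coord j) t • (b i ⊗ₜ[ℂ] toConj (b j)) := by
  induction t using TensorProduct.induction_on with
  | zero => simp
  | add x y hx hy =>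
    simp only [map_add, add_smul, Finset.sum_add_distrib]
    rw [← hx, ← hy]
  | tmul v w =>
    obtain ⟨w, rfl⟩ : ∃ w' : W, toConj w' = w := ⟨w, rfl⟩
    have hw : toConj w = ∑ j, conj (b.coord j w) • toConj (b j) := by
      conv_lhs => rw [← b.sum_repr w, toConj_sum]
      simp only [toConj_smul, Module.Basis.coord_apply]
    have hv : v = ∑ i, b.coord i v • b i := by
      conv_lhs => rw [← b.sum_repr v]
      simp only [Module.Basis.coord_apply]
    conv_lhs => rw [hv, hw]
    simp only [TensorProduct.sum_tmul, TensorProduct.tmul_sum, tensorForm_tmul,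
      TensorProduct.smul_tmul_smul]
    exact Finset.sum_comm

theorem tensorForm_eq_sum {ι : Type*} [Fintype ι] (b : Module.Basis ι ℂ W) (ξ η : W →ₗ[ℂ] ℂ)
    (t : W ⊗[ℂ] Conj W) :
    tensorForm ξ η t =
      ∑ i, ∑ j, tensorForm (b.coord i) (b.coord j) t * (ξ (b i) * conj (η (b j))) := by
  conv_lhs => rw [eq_sum_tensorForm_smul b t]
  simp only [map_sum, map_smul, tensorForm_tmul, smul_eq_mul]

end TensorForms

/-- A linear map that is bounded by finitely many of the maps `Φ i` is continuous in the topology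
that they induce. -/
theorem continuous_of_norm_le_sum {M : Type*} [AddCommGroup M] [Module ℝ M] {ι : Type*}
    {N : ι → Type*} [∀ i, NormedAddCommGroup (N i)] [∀ i, NormedSpace ℝ (N i)]
    (Φ : ∀ i, M →ₗ[ℝ] N i) {N' : Type*} [NormedAddCommGroup N'] [NormedSpace ℝ N']
    (L : M →ₗ[ℝ] N') (S : Finset ι) (C : ℝ) (h : ∀ k, ‖L k‖ ≤ C * ∑ i ∈ S, ‖Φ i k‖) :
    Continuous[TopologicalSpace.induced (fun k i => Φ i k) inferInstance, inferInstance] L := by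
  let _ : TopologicalSpace M := TopologicalSpace.induced (fun k i => Φ i k) inferInstance
  have hind : Topology.IsInducing (LinearMap.pi Φ) := ⟨rfl⟩
  have : IsTopologicalAddGroup M := topologicalAddGroup_induced (LinearMap.pi Φ)
  have hΦ : ∀ i, Continuous (Φ i) := fun i => (continuous_apply i).comp hind.continuous
  refine continuous_of_continuousAt_zero L ?_
  rw [ContinuousAt, map_zero]
  refine squeeze_zero_norm h ?_
  have : Continuous fun k => C * ∑ i ∈ S, ‖Φ i k‖ := by fun_prop
  simpa using this.tendsto 0

/-! ### Local coefficients in different coordinates -/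

section Coefficients

variable {V : Type*} [NormedAddCommGroup V] [NormedSpace ℂ V]
  {X : Type*} [TopologicalSpace X] [ChartedSpace V X]
  {F : Type*} [NormedAddCommGroup F] [NormedSpace ℂ F]
  {E : X → Type*} [∀ x, AddCommGroup (E x)] [∀ x, Module ℂ (E x)]
  [∀ x, TopologicalSpace (E x)] [TopologicalSpace (TotalSpace F E)]
  [FiberBundle F E] [VectorBundle ℂ F E]

variable (V F E) in
theorem isOpen_localDomain (x₀ : X) : IsOpen (localDomain V F E x₀) :=
  (chartAt V x₀).isOpen_inter_preimage_symm (trivializationAt F E x₀).open_baseSet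

variable (V F E) in
/-- The part of `localDomain V F E x₀` that lies in the domain of the coordinates at `x₁`. -/
def overlap (x₀ x₁ : X) : Set V :=
  localDomain V F E x₀ ∩ (chartAt V x₀).symm ⁻¹'
    ((chartAt V x₁).source ∩ (trivializationAt F E x₁).baseSet)

variable (V F E) in
theorem isOpen_overlap (x₀ x₁ : X) : IsOpen (overlap V F E x₀ x₁) := by
  have h : overlap V F E x₀ x₁ = (chartAt V x₀).target ∩ (chartAt V x₀).symm ⁻¹'
      ((trivializationAt F E x₀).baseSet ∩
        ((chartAt V x₁).source ∩ (trivializationAt F E x₁).baseSet)) := by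
    rw [overlap, localDomain, inter_assoc]; rfl
  rw [h]
  exact (chartAt V x₀).isOpen_inter_preimage_symm ((trivializationAt F E x₀).open_baseSet.inter
    ((chartAt V x₁).open_source.inter (trivializationAt F E x₁).open_baseSet))

theorem mem_localDomain_of_mem {x₁ x : X} (h1 : x ∈ (chartAt V x₁).source)
    (h2 : x ∈ (trivializationAt F E x₁).baseSet) : chartAt V x₁ x ∈ localDomain V F E x₁ := by
  refine ⟨(chartAt V x₁).map_source h1, ?_⟩
  rw [mem_preimage, (chartAt V x₁).left_inv h1]
  exact h2

theorem mapsTo_overlap (x₀ x₁ : X) :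
    MapsTo (chartAt V x₁ ∘ (chartAt V x₀).symm) (overlap V F E x₀ x₁) (localDomain V F E x₁) :=
  fun _ hz => mem_localDomain_of_mem hz.2.1 hz.2.2

theorem contMDiffOn_chart_symm_localDomain [IsManifold 𝓘(ℂ, V) ω X] (x₀ : X) :
    ContMDiffOn 𝓘(ℂ, V) 𝓘(ℂ, V) ω (chartAt V x₀).symm (localDomain V F E x₀) :=
  (contMDiffOn_chart_symm (I := 𝓘(ℂ, V)) (n := ω) (x := x₀)).mono inter_subset_left

theorem contDiffOn_transition [IsManifold 𝓘(ℂ, V) ω X] (x₀ x₁ : X) :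
    ContDiffOn ℝ ∞ (chartAt V x₁ ∘ (chartAt V x₀).symm) (overlap V F E x₀ x₁) := by
  have h : ContMDiffOn 𝓘(ℂ, V) 𝓘(ℂ, V) ω (chartAt V x₁ ∘ (chartAt V x₀).symm)
      (overlap V F E x₀ x₁) :=
    (contMDiffOn_chart (I := 𝓘(ℂ, V)) (n := ω) (x := x₁)).comp
      ((contMDiffOn_chart_symm_localDomain x₀).mono inter_subset_left) (fun z hz => hz.2.1)
  exact (h.contDiffOn.restrict_scalars ℝ).of_le le_top

/-- The bundle transition from the trivialization at `x₁` to the one at `x₀`, in coordinates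
at `x₀`. -/
noncomputable def coordChange (V F : Type*) [NormedAddCommGroup V] [NormedSpace ℂ V]
    {X : Type*} [TopologicalSpace X] [ChartedSpace V X] [NormedAddCommGroup F] [NormedSpace ℂ F]
    (E : X → Type*) [∀ x, AddCommGroup (E x)] [∀ x, Module ℂ (E x)]
    [∀ x, TopologicalSpace (E x)] [TopologicalSpace (TotalSpace F E)]
    [FiberBundle F E] [VectorBundle ℂ F E] (x₀ x₁ : X) (z : V) : F →L[ℂ] F :=
  (trivializationAt F E x₁).coordChangeL ℂ (trivializationAt F E x₀) ((chartAt V x₀).symm z)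

theorem contDiffOn_coordChange [IsManifold 𝓘(ℂ, V) ω X] [ContMDiffVectorBundle ω F E 𝓘(ℂ, V)]
    (x₀ x₁ : X) : ContDiffOn ℝ ∞ (coordChange V F E x₀ x₁) (overlap V F E x₀ x₁) := by
  have h : ContMDiffOn 𝓘(ℂ, V) 𝓘(ℂ, F →L[ℂ] F) ω (coordChange V F E x₀ x₁)
      (overlap V F E x₀ x₁) :=
    (contMDiffOn_coordChangeL (n := ω) (IB := 𝓘(ℂ, V)) (trivializationAt F E x₁)
      (trivializationAt F E x₀)).comp
      ((contMDiffOn_chart_symm_localDomain x₀).mono inter_subset_left)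
      (fun z hz => ⟨hz.2.2, hz.1.2⟩)
  exact (h.contDiffOn.restrict_scalars ℝ).of_le le_top

variable [FiniteDimensional ℂ F]

variable (F) in
/-- The coordinate forms of a fixed basis of the model fiber. -/
noncomputable def fiberForm (a : Fin (Module.finrank ℂ F)) : F →L[ℂ] ℂ :=
  LinearMap.toContinuousLinearMap ((Module.finBasis ℂ F).coord a)

/-- The basis of the fiber `E x` that corresponds to the fixed basis of the model fiber under the
trivialization at `x₁`. -/
noncomputable def fiberBasis {x₁ x : X} (hx : x ∈ (trivializationAt F E x₁).baseSet) :
    Module.Basis (Fin (Module.finrank ℂ F)) ℂ (E x) :=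
  (Module.finBasis ℂ F).map ((trivializationAt F E x₁).linearEquivAt ℂ x hx).symm

theorem fiberBasis_coord {x₁ x : X} (hx : x ∈ (trivializationAt F E x₁).baseSet)
    (a : Fin (Module.finrank ℂ F)) : (fiberBasis hx).coord a =
      (fiberForm F a : F →ₗ[ℂ] ℂ) ∘ₗ (trivializationAt F E x₁).linearMapAt ℂ x := by
  ext v
  have h : (trivializationAt F E x₁).linearMapAt ℂ x v =
      (trivializationAt F E x₁).linearEquivAt ℂ x hx v := by
    rw [Trivialization.linearMapAt_apply, if_pos hx]; rfl
  rw [LinearMap.comp_apply, h]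
  rfl

theorem tensorForm_eq_sum_localCoeff {x₁ x : X} (h1 : x ∈ (chartAt V x₁).source)
    (h2 : x ∈ (trivializationAt F E x₁).baseSet) (ξ η : E x →ₗ[ℂ] ℂ)
    (k : ∀ x, E x ⊗[ℂ] Conj (E x)) :
    tensorForm ξ η (k x) = ∑ a, ∑ b,
      localCoeff V x₁ (fiberForm F a) (fiberForm F b) k (chartAt V x₁ x) *
        (ξ (fiberBasis h2 a) * conj (η (fiberBasis h2 b))) := by
  rw [tensorForm_eq_sum (fiberBasis h2)]
  simp only [fiberBasis_coord, localCoeff]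
  rw [(chartAt V x₁).left_inv h1]

/-- The change of coordinates: each summand is a coefficient at `x₁` composed with the chart
transition, times a smooth factor independent of the section. This is the shape g(φ(z)) c(z) for
which derivative bounds were prepared. -/
theorem localCoeff_eq_sum {x₀ x₁ : X} {z : V} (hz : z ∈ overlap V F E x₀ x₁) (ξ η : F →L[ℂ] ℂ)
    (k : ∀ x, E x ⊗[ℂ] Conj (E x)) :
    localCoeff V x₀ ξ η k z = ∑ a, ∑ b,
      localCoeff V x₁ (fiberForm F a) (fiberForm F b) k
        ((chartAt V x₁ ∘ (chartAt V x₀).symm) z) *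
        (ξ (coordChange V F E x₀ x₁ z (Module.finBasis ℂ F a)) *
          conj (η (coordChange V F E x₀ x₁ z (Module.finBasis ℂ F b)))) := by
  have hb : ∀ a, (trivializationAt F E x₀).linearMapAt ℂ ((chartAt V x₀).symm z)
      (fiberBasis hz.2.2 a) = coordChange V F E x₀ x₁ z (Module.finBasis ℂ F a) := by
    intro a
    have hmem : (chartAt V x₀).symm z ∈ (trivializationAt F E x₀).baseSet := hz.1.2
    rw [Trivialization.linearMapAt_apply, if_pos hmem, coordChange]
    erw [Trivialization.coordChangeL_apply _ _ ⟨hz.2.2, hz.1.2⟩]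
    rfl
  rw [localCoeff, tensorForm_eq_sum_localCoeff hz.2.1 hz.2.2]
  simp only [LinearMap.comp_apply, hb]
  rfl

/-- A section of `E ⊗ Ē` is zero if all its coefficients are. -/
theorem eq_zero_of_localCoeff_eq_zero {k : ∀ x, E x ⊗[ℂ] Conj (E x)} {x₁ x : X}
    (h1 : x ∈ (chartAt V x₁).source) (h2 : x ∈ (trivializationAt F E x₁).baseSet)
    (h : ∀ a b, localCoeff V x₁ (fiberForm F a) (fiberForm F b) k (chartAt V x₁ x) = 0) :
    k x = 0 := by
  rw [eq_sum_tensorForm_smul (fiberBasis h2) (k x)]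
  refine Finset.sum_eq_zero fun a _ => Finset.sum_eq_zero fun b _ => ?_
  have := h a b
  rw [localCoeff] at this
  simp only [fiberBasis_coord]
  rw [(chartAt V x₁).left_inv h1] at this
  rw [this, zero_smul]

/-- Local bound for the derivatives of the coefficients at `x₀` by those at `x₁`. -/
theorem exists_norm_iteratedFDeriv_localCoeff_le_of_mem_overlap [IsManifold 𝓘(ℂ, V) ω X]
    [ContMDiffVectorBundle ω F E 𝓘(ℂ, V)]
    {x₀ x₁ : X} {z₀ : V} (hz₀ : z₀ ∈ overlap V F E x₀ x₁) (ξ η : F →L[ℂ] ℂ) (n : ℕ) :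
    ∃ C : ℝ, 0 ≤ C ∧ ∀ᶠ z in 𝓝 z₀, ∀ k ∈ smoothSections V F E, ∀ B : ℝ,
      (∀ a b, ∀ m ≤ n, ‖iteratedFDeriv ℝ m (localCoeff V x₁ (fiberForm F a) (fiberForm F b) k)
        (chartAt V x₁ ((chartAt V x₀).symm z))‖ ≤ B) →
      ‖iteratedFDeriv ℝ n (localCoeff V x₀ ξ η k) z‖ ≤ C * B := by
  set c : Fin (Module.finrank ℂ F) → Fin (Module.finrank ℂ F) → V → ℂ := fun a b z =>
    ξ (coordChange V F E x₀ x₁ z (Module.finBasis ℂ F a)) *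
          conj (η (coordChange V F E x₀ x₁ z (Module.finBasis ℂ F b))) with hc
  have hO := isOpen_overlap V F E x₀ x₁
  have h1 (ξ : F →L[ℂ] ℂ) (a) : ContDiffOn ℝ ∞
      (fun z => ξ (coordChange V F E x₀ x₁ z (Module.finBasis ℂ F a))) (overlap V F E x₀ x₁) :=
    (((ξ ∘L ContinuousLinearMap.apply ℂ F (Module.finBasis ℂ F a)).restrictScalars ℝ)).contDiff
      |>.comp_contDiffOn (contDiffOn_coordChange x₀ x₁)
  have hcs : ∀ a b, ContDiffOn ℝ ∞ (c a b) (overlap V F E x₀ x₁) := fun a b =>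
    (h1 ξ a).mul (Complex.conjCLE.contDiff.comp_contDiffOn (h1 η b))
  choose C hC0 hC using fun a b => exists_norm_iteratedFDeriv_comp_mul_le hO
    (isOpen_localDomain V F E x₁) (contDiffOn_transition x₀ x₁) (hcs a b)
    (mapsTo_overlap x₀ x₁) n hz₀
  refine ⟨∑ a, ∑ b, C a b, Finset.sum_nonneg fun a _ => Finset.sum_nonneg fun b _ => hC0 a b, ?_⟩
  filter_upwards [eventually_all.2 fun a => eventually_all.2 fun b => hC a b, hO.mem_nhds hz₀]
    with z hz hzO k hk B hB
  rw [← iteratedFDerivWithin_of_isOpen n hO hzO,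
    iteratedFDerivWithin_congr (fun z hz => localCoeff_eq_sum hz ξ η k) hzO]
  have hs : ∀ a b, ContDiffOn ℝ ∞ (fun z => localCoeff V x₁ (fiberForm F a) (fiberForm F b) k
        ((chartAt V x₁ ∘ (chartAt V x₀).symm) z) * c a b z) (overlap V F E x₀ x₁) := fun a b =>
    ((hk x₁ _ _).comp (contDiffOn_transition x₀ x₁) (mapsTo_overlap x₀ x₁)).mul (hcs a b)
  have hs' : ∀ a b, ContDiffWithinAt ℝ n
      (fun z => localCoeff V x₁ (fiberForm F a) (fiberForm F b) k
        ((chartAt V x₁ ∘ (chartAt V x₀).symm) z) * c a b z) (overlap V F E x₀ x₁) z :=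
    fun a b => (hs a b z hzO).of_le (by exact_mod_cast le_top)
  rw [iteratedFDerivWithin_fun_sum_apply hO.uniqueDiffOn hzO
    (fun a _ => ContDiffWithinAt.sum fun b _ => hs' a b), Finset.sum_mul]
  refine (norm_sum_le _ _).trans (Finset.sum_le_sum fun a _ => ?_)
  rw [iteratedFDerivWithin_fun_sum_apply hO.uniqueDiffOn hzO (fun b _ => hs' a b), Finset.sum_mul]
  refine (norm_sum_le _ _).trans (Finset.sum_le_sum fun b _ => ?_)
  rw [iteratedFDerivWithin_of_isOpen n hO hzO]
  exact hz a b _ (hk x₁ _ _) B (hB a b)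

end Coefficients

/-! ### Finite covers by coordinate balls -/

section Cover

/-- A finite cover of `X` by coordinate balls such that the balls of twice the radius lie in the
domains of the local coordinates. -/
structure BallCover (V : Type*) [NormedAddCommGroup V] [NormedSpace ℂ V]
    {X : Type*} [TopologicalSpace X] [ChartedSpace V X]
    (F : Type*) [NormedAddCommGroup F] [NormedSpace ℂ F]
    (E : X → Type*) [∀ x, AddCommGroup (E x)] [∀ x, Module ℂ (E x)]
    [∀ x, TopologicalSpace (E x)] [TopologicalSpace (TotalSpace F E)]
    [FiberBundle F E] [VectorBundle ℂ F E] where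
  /-- the centers of the balls -/
  centers : Finset X
  /-- the radii of the balls -/
  radius : X → ℝ
  radius_pos : ∀ x, 0 < radius x
  closedBall_subset : ∀ x,
    Metric.closedBall (chartAt V x x) (2 * radius x) ⊆ localDomain V F E x
  cover : ∀ y : X, ∃ x ∈ centers, y ∈ (chartAt V x).source ∧
    chartAt V x y ∈ Metric.ball (chartAt V x x) (radius x)

variable {V : Type*} [NormedAddCommGroup V] [NormedSpace ℂ V]
  {X : Type*} [TopologicalSpace X] [ChartedSpace V X]
  {F : Type*} [NormedAddCommGroup F] [NormedSpace ℂ F]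
  {E : X → Type*} [∀ x, AddCommGroup (E x)] [∀ x, Module ℂ (E x)]
  [∀ x, TopologicalSpace (E x)] [TopologicalSpace (TotalSpace F E)]
  [FiberBundle F E] [VectorBundle ℂ F E]

variable (V F E) in
theorem chartAt_mem_localDomain (x : X) : chartAt V x x ∈ localDomain V F E x :=
  mem_localDomain_of_mem (mem_chart_source V x) (FiberBundle.mem_baseSet_trivializationAt F E x)

variable (V F E) in
theorem nonempty_ballCover [CompactSpace X] : Nonempty (BallCover V F E) := by
  have h : ∀ x : X, ∃ r : ℝ, 0 < r ∧
      Metric.closedBall (chartAt V x x) (2 * r) ⊆ localDomain V F E x := by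
    intro x
    obtain ⟨ε, hε, hε'⟩ := Metric.nhds_basis_closedBall.mem_iff.1
      ((isOpen_localDomain V F E x).mem_nhds (chartAt_mem_localDomain V F E x))
    exact ⟨ε / 2, by positivity, by rwa [mul_div_cancel₀ _ two_ne_zero]⟩
  choose r hr hr' using h
  obtain ⟨t, ht⟩ := isCompact_univ.elim_nhds_subcover
    (fun x : X => (chartAt V x).source ∩ chartAt V x ⁻¹' Metric.ball (chartAt V x x) (r x))
    (fun x _ => ((chartAt V x).isOpen_inter_preimage Metric.isOpen_ball).mem_nhds
      ⟨mem_chart_source V x, Metric.mem_ball_self (hr x)⟩)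
  refine ⟨⟨t, r, hr, hr', fun y => ?_⟩⟩
  simpa [and_left_comm] using ht.2 (mem_univ y)

variable (C : BallCover V F E)

namespace BallCover

theorem closedBall_subset' (x : X) :
    Metric.closedBall (chartAt V x x) (C.radius x) ⊆ localDomain V F E x :=
  (Metric.closedBall_subset_closedBall (by linarith [C.radius_pos x])).trans (C.closedBall_subset x)

theorem mem_baseSet {x y : X} (h1 : y ∈ (chartAt V x).source)
    (h2 : chartAt V x y ∈ Metric.ball (chartAt V x x) (C.radius x)) :
    y ∈ (trivializationAt F E x).baseSet := by
  have := (C.closedBall_subset' x (Metric.ball_subset_closedBall h2)).2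
  rwa [mem_preimage, (chartAt V x).left_inv h1] at this

/-- The derivatives of all coefficients are bounded by those of finitely many coefficients on the
balls of the cover. -/
theorem exists_norm_iteratedFDeriv_localCoeff_le [FiniteDimensional ℂ F] [IsManifold 𝓘(ℂ, V) ω X]
    [ContMDiffVectorBundle ω F E 𝓘(ℂ, V)]
    (x₀ : X) (ξ η : F →L[ℂ] ℂ) (n : ℕ) {K : Set V} (hK : IsCompact K)
    (hKd : K ⊆ localDomain V F E x₀) :
    ∃ A : ℝ, 0 ≤ A ∧ ∀ k ∈ smoothSections V F E, ∀ B : ℝ, 0 ≤ B →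
      (∀ x ∈ C.centers, ∀ a b, ∀ m ≤ n,
        ∀ w ∈ Metric.closedBall (chartAt V x x) (C.radius x),
        ‖iteratedFDeriv ℝ m (localCoeff V x (fiberForm F a) (fiberForm F b) k) w‖ ≤ B) →
      ∀ z ∈ K, ‖iteratedFDeriv ℝ n (localCoeff V x₀ ξ η k) z‖ ≤ A * B := by
  -- Having a uniform constant passes to subsets and finite unions, so it only has to be found near
  -- each point of `K`.
  refine hK.induction_on (p := fun K => ∃ A : ℝ, 0 ≤ A ∧ ∀ k ∈ smoothSections V F E, ∀ B : ℝ,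
      0 ≤ B → (∀ x ∈ C.centers, ∀ a b, ∀ m ≤ n,
        ∀ w ∈ Metric.closedBall (chartAt V x x) (C.radius x),
        ‖iteratedFDeriv ℝ m (localCoeff V x (fiberForm F a) (fiberForm F b) k) w‖ ≤ B) →
      ∀ z ∈ K, ‖iteratedFDeriv ℝ n (localCoeff V x₀ ξ η k) z‖ ≤ A * B) ?_ ?_ ?_ ?_
  · exact ⟨0, le_rfl, fun k _ B _ _ z hz => hz.elim⟩
  · rintro s t hst ⟨A, hA, h⟩
    exact ⟨A, hA, fun k hk B hB0 hB z hz => h k hk B hB0 hB z (hst hz)⟩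
  · rintro s t ⟨A, hA, h⟩ ⟨A', hA', h'⟩
    refine ⟨A + A', by positivity, fun k hk B hB0 hB z hz => ?_⟩
    rw [add_mul]
    rcases hz with hz | hz
    · exact (h k hk B hB0 hB z hz).trans (le_add_of_nonneg_right (by positivity))
    · exact (h' k hk B hB0 hB z hz).trans (le_add_of_nonneg_left (by positivity))
  · intro z₀ hz₀
    -- Some ball of the cover contains the point, and by continuity the chart transition maps a
    -- neighbourhood into that ball, where the assumed bound applies.
    obtain ⟨x, hx, h1, h2⟩ := C.cover ((chartAt V x₀).symm z₀)
    have hO : z₀ ∈ overlap V F E x₀ x := ⟨hKd hz₀, h1, C.mem_baseSet h1 h2⟩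
    obtain ⟨A, hA, h⟩ := exists_norm_iteratedFDeriv_localCoeff_le_of_mem_overlap hO ξ η n
    have hcont : ContinuousAt (chartAt V x ∘ (chartAt V x₀).symm) z₀ :=
      (contDiffOn_transition x₀ x).continuousOn.continuousAt
        ((isOpen_overlap V F E x₀ x).mem_nhds hO)
    have hball := hcont.eventually (Metric.isOpen_ball.mem_nhds h2)
    refine ⟨_, nhdsWithin_le_nhds (h.and hball), A, hA, fun k hk B _ hB z hz => ?_⟩
    exact hz.1 k hk B fun a b m hm => hB x hx a b m hm _ (Metric.ball_subset_closedBall hz.2)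

end BallCover

end Cover

/-! ### The Fréchet space of smooth sections -/

section Frechet

variable {V : Type*} [NormedAddCommGroup V] [NormedSpace ℂ V]
  {X : Type*} [TopologicalSpace X] [ChartedSpace V X]
  {F : Type*} [NormedAddCommGroup F] [NormedSpace ℂ F]
  {E : X → Type*} [∀ x, AddCommGroup (E x)] [∀ x, Module ℂ (E x)]
  [∀ x, TopologicalSpace (E x)] [TopologicalSpace (TotalSpace F E)]
  [FiberBundle F E] [VectorBundle ℂ F E]

namespace SmoothSections

theorem val_add (k l : SmoothSections V F E) : (k + l).val = k.val + l.val := rfl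

theorem val_smul (c : ℂ) (k : SmoothSections V F E) : (c • k).val = c • k.val := rfl

theorem val_real_smul (c : ℝ) (k : SmoothSections V F E) : (c • k).val = (c : ℂ) • k.val := rfl

theorem val_sum {ι : Type*} (s : Finset ι) (f : ι → SmoothSections V F E) (x : X) :
    (∑ i ∈ s, f i).val x = ∑ i ∈ s, (f i).val x := by
  induction s using Finset.cons_induction with
  | empty => rfl
  | cons a s ha ih => rw [Finset.sum_cons, Finset.sum_cons, val_add, Pi.add_apply, ih]

theorem ext {k l : SmoothSections V F E} (h : ∀ x, k.val x = l.val x) : k = l :=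
  Subtype.ext (funext h)

theorem contDiffOn (k : SmoothSections V F E) (x₀ : X) (ξ η : F →L[ℂ] ℂ) :
    ContDiffOn ℝ ∞ (localCoeff V x₀ ξ η k.val) (localDomain V F E x₀) := k.2 x₀ ξ η

end SmoothSections

variable (V F E) in
/-- The data that determine a seminorm on the space of smooth sections. -/
structure CoeffIndex where
  /-- the center of the coordinates -/
  pt : X
  /-- the first linear form -/
  left : F →L[ℂ] ℂ
  /-- the second linear form -/
  right : F →L[ℂ] ℂ
  /-- the order of the derivatives -/
  order : ℕ
  /-- the compact set on which the derivatives are considered -/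
  compacts : TopologicalSpace.Compacts V
  subset : (compacts : Set V) ⊆ localDomain V F E pt

/-- The space of continuous functions on a compact set in which the derivatives of local
coefficients take their values, a Banach space. -/
def CoeffSpace (i : CoeffIndex V F E) : Type _ := C(i.compacts, V [×i.order]→L[ℝ] ℂ)

namespace CoeffSpace

noncomputable instance (i : CoeffIndex V F E) : NormedAddCommGroup (CoeffSpace i) :=
  inferInstanceAs (NormedAddCommGroup C(i.compacts, V [×i.order]→L[ℝ] ℂ))

noncomputable instance (i : CoeffIndex V F E) : NormedSpace ℝ (CoeffSpace i) :=
  inferInstanceAs (NormedSpace ℝ C(i.compacts, V [×i.order]→L[ℝ] ℂ))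

instance (i : CoeffIndex V F E) : CompleteSpace (CoeffSpace i) :=
  inferInstanceAs (CompleteSpace C(i.compacts, V [×i.order]→L[ℝ] ℂ))

variable {i : CoeffIndex V F E}

/-- The value of an element of `CoeffSpace i`. -/
noncomputable def val (f : CoeffSpace i) (z : i.compacts) : V [×i.order]→L[ℝ] ℂ :=
  (show C(i.compacts, V [×i.order]→L[ℝ] ℂ) from f) z

theorem ext {f g : CoeffSpace i} (h : ∀ z, f.val z = g.val z) : f = g := ContinuousMap.ext h

theorem norm_val_le (f : CoeffSpace i) (z : i.compacts) : ‖f.val z‖ ≤ ‖f‖ :=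
  ContinuousMap.norm_coe_le_norm (show C(i.compacts, V [×i.order]→L[ℝ] ℂ) from f) z

theorem norm_le (f : CoeffSpace i) {B : ℝ} (hB : 0 ≤ B) (h : ∀ z, ‖f.val z‖ ≤ B) : ‖f‖ ≤ B :=
  (ContinuousMap.norm_le (show C(i.compacts, V [×i.order]→L[ℝ] ℂ) from f) hB).2 h

theorem isInducing_ofFun :
    Topology.IsInducing fun f : CoeffSpace i => UniformFun.ofFun f.val :=
  ContinuousMap.isUniformEmbedding_uniformFunOfFun.isUniformInducing.isInducing

theorem tendsto_iff_tendstoUniformly {ι : Type*} {l : Filter ι} {f : ι → CoeffSpace i}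
    {g : CoeffSpace i} :
    Tendsto f l (𝓝 g) ↔ TendstoUniformly (fun j z => (f j).val z) g.val l :=
  ContinuousMap.tendsto_iff_tendstoUniformly

end CoeffSpace

/-- The restrictions of the derivatives of a local coefficient to a compact set. -/
noncomputable def coeffMap (i : CoeffIndex V F E) :
    SmoothSections V F E →ₗ[ℝ] CoeffSpace i where
  toFun k := ContinuousMap.mk (fun z => iteratedFDeriv ℝ i.order (localCoeff V i.pt i.left i.right k.val) z) (by
    have h := (k.contDiffOn i.pt i.left i.right).continuousOn_iteratedFDerivWithin
      (m := i.order) (by exact_mod_cast le_top) (isOpen_localDomain V F E i.pt).uniqueDiffOn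
    exact (h.congr (iteratedFDerivWithin_of_isOpen _ (isOpen_localDomain V F E i.pt)).symm).mono
      i.subset |>.domRestrict)
  map_add' k l := by
    refine CoeffSpace.ext fun z => ?_
    have hz := (isOpen_localDomain V F E i.pt).mem_nhds (i.subset z.2)
    have h (k : SmoothSections V F E) := ((k.contDiffOn i.pt i.left i.right).contDiffAt hz).of_le
      (m := i.order) (by exact_mod_cast le_top)
    change iteratedFDeriv ℝ i.order (localCoeff V i.pt i.left i.right (k + l).val) z = _
    rw [SmoothSections.val_add, localCoeff_add, iteratedFDeriv_add_apply (h k) (h l)]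
    rfl
  map_smul' c k := by
    refine CoeffSpace.ext fun z => ?_
    have hz := (isOpen_localDomain V F E i.pt).mem_nhds (i.subset z.2)
    have h := ((k.contDiffOn i.pt i.left i.right).contDiffAt hz).of_le
      (m := i.order) (by exact_mod_cast le_top)
    change iteratedFDeriv ℝ i.order (localCoeff V i.pt i.left i.right (c • k).val) z = _
    have h2 : (c : ℂ) • localCoeff V i.pt i.left i.right k.val =
      c • localCoeff V i.pt i.left i.right k.val := rfl
    rw [SmoothSections.val_real_smul, localCoeff_smul, h2, iteratedFDeriv_const_smul_apply h]
    rfl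

/-- Uniform convergence on a family of compact sets is uniform convergence on each of them, and
there the derivatives form a continuous map. The topology is thus generated by linear maps into
Banach spaces. -/
theorem topologicalSpace_eq_iInf_coeffMap :
    (inferInstance : TopologicalSpace (SmoothSections V F E)) =
      ⨅ i : CoeffIndex V F E, TopologicalSpace.induced (coeffMap i) inferInstance := by
  refine le_antisymm ?_ ?_
  · refine le_iInf fun i => ?_
    rw [← continuous_iff_le_induced, CoeffSpace.isInducing_ofFun.continuous_iff]
    have h : Continuous fun k : SmoothSections V F E =>
        UniformOnFun.ofFun {K : Set V | IsCompact K ∧ K ⊆ localDomain V F E i.pt}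
        (iteratedFDeriv ℝ i.order (localCoeff V i.pt i.left i.right k.val)) := by
      rw [continuous_iff_le_induced]
      exact iInf_le_of_le i.pt <| iInf_le_of_le i.left <| iInf_le_of_le i.right <|
        iInf_le_of_le i.order le_rfl
    exact UniformOnFun.continuous_rng_iff.1 h i.compacts ⟨i.compacts.isCompact, i.subset⟩
  · refine le_iInf fun x₀ => le_iInf fun ξ => le_iInf fun η => le_iInf fun n => ?_
    rw [← continuous_iff_le_induced]
    refine (@UniformOnFun.continuous_rng_iff _ _ _ _ _
      (⨅ i : CoeffIndex V F E, TopologicalSpace.induced (coeffMap i) inferInstance) _).2 ?_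
    rintro K ⟨hK, hKd⟩
    let i : CoeffIndex V F E := ⟨x₀, ξ, η, n, ⟨K, hK⟩, hKd⟩
    have h : Continuous[⨅ i : CoeffIndex V F E, TopologicalSpace.induced (coeffMap i) inferInstance,
        inferInstance] (coeffMap i) := continuous_iff_le_induced.2 (iInf_le _ i)
    exact @Continuous.comp _ _ _ (_) _ _ (coeffMap i) (fun f => UniformFun.ofFun f.val)
      CoeffSpace.isInducing_ofFun.continuous h

theorem continuous_coeffMap (i : CoeffIndex V F E) : Continuous (coeffMap i) := by
  rw [continuous_iff_le_induced]
  exact topologicalSpace_eq_iInf_coeffMap.le.trans (iInf_le _ i)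

namespace BallCover

variable [FiniteDimensional ℂ V]

/-- The coefficients on the balls of a finite cover: a countable family. -/
noncomputable def coeffIndex (C : BallCover V F E)
    (j : C.centers × Fin (Module.finrank ℂ F) × Fin (Module.finrank ℂ F) × ℕ)
    [FiniteDimensional ℂ F] : CoeffIndex V F E where
  pt := j.1
  left := fiberForm F j.2.1
  right := fiberForm F j.2.2.1
  order := j.2.2.2
  compacts := ⟨Metric.closedBall (chartAt V j.1.1 j.1.1) (C.radius j.1), by
    have := FiniteDimensional.proper ℂ V
    exact isCompact_closedBall _ _⟩
  subset := C.closedBall_subset' j.1.1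

variable [FiniteDimensional ℂ F] [IsManifold 𝓘(ℂ, V) ω X] [ContMDiffVectorBundle ω F E 𝓘(ℂ, V)]

/-- The joint coefficient map of a finite cover. -/
noncomputable def coeffMap (C : BallCover V F E) :
    SmoothSections V F E →ₗ[ℝ] ∀ j, CoeffSpace (C.coeffIndex j) :=
  LinearMap.pi fun j => Bergman.coeffMap (C.coeffIndex j)

/-- The basic estimate in terms of norms: only derivatives up to the given order, on the finitely
many balls, are involved. Hence a countable family of seminorms suffices. -/
theorem exists_norm_coeffMap_le (C : BallCover V F E) (i : CoeffIndex V F E) :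
    ∃ (S : Finset (C.centers × Fin (Module.finrank ℂ F) × Fin (Module.finrank ℂ F) × ℕ)) (A : ℝ),
      ∀ k, ‖Bergman.coeffMap i k‖ ≤ A * ∑ j ∈ S, ‖Bergman.coeffMap (C.coeffIndex j) k‖ := by
  classical
  obtain ⟨A, hA, h⟩ := C.exists_norm_iteratedFDeriv_localCoeff_le i.pt i.left i.right i.order
    i.compacts.isCompact i.subset
  refine ⟨Finset.univ ×ˢ Finset.univ ×ˢ Finset.univ ×ˢ Finset.range (i.order + 1), A,
    fun k => ?_⟩
  have hs : 0 ≤ ∑ j ∈ Finset.univ ×ˢ Finset.univ ×ˢ Finset.univ ×ˢ Finset.range (i.order + 1),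
    ‖Bergman.coeffMap (C.coeffIndex j) k‖ := Finset.sum_nonneg fun j _ => norm_nonneg (Bergman.coeffMap (C.coeffIndex j) k)
  refine CoeffSpace.norm_le _ (mul_nonneg hA hs) fun z => ?_
  refine h k.val k.2 _ hs (fun x hx a b m hm w hw => ?_) z z.2
  have h1 := Finset.single_le_sum (f := fun j => ‖Bergman.coeffMap (C.coeffIndex j) k‖)
    (s := Finset.univ ×ˢ Finset.univ ×ˢ Finset.univ ×ˢ Finset.range (i.order + 1))
    (fun j _ => norm_nonneg (Bergman.coeffMap (C.coeffIndex j) k)) (a := (⟨x, hx⟩, a, b, m)) (by simpa using Nat.lt_succ_of_le hm)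
  refine le_trans ?_ h1
  exact CoeffSpace.norm_val_le (Bergman.coeffMap (C.coeffIndex (⟨x, hx⟩, a, b, m)) k) ⟨w, hw⟩

/-- Vector space topology, local convexity and, with injectivity, metrizability are inherited from
the countable product of Banach spaces. -/
theorem isInducing_coeffMap (C : BallCover V F E) : Topology.IsInducing C.coeffMap := by
  refine ⟨le_antisymm ?_ ?_⟩
  · rw [← continuous_iff_le_induced]
    exact continuous_pi fun j => continuous_coeffMap _
  · refine le_of_le_of_eq (le_iInf fun i => ?_) topologicalSpace_eq_iInf_coeffMap.symm
    rw [← continuous_iff_le_induced]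
    obtain ⟨S, A, h⟩ := C.exists_norm_coeffMap_le i
    exact continuous_of_norm_le_sum (fun j => Bergman.coeffMap (C.coeffIndex j))
      (Bergman.coeffMap i) S A h

theorem injective_coeffMap (C : BallCover V F E) : Function.Injective C.coeffMap := by
  refine (injective_iff_map_eq_zero _).2 fun k hk => SmoothSections.ext fun y => ?_
  obtain ⟨x, hx, h1, h2⟩ := C.cover y
  refine eq_zero_of_localCoeff_eq_zero h1 (C.mem_baseSet h1 h2) fun a b => ?_
  -- Order 0 suffices; the value of the coefficient is recovered by evaluating a 0-linear map on the
  -- empty tuple.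
  have h3 := congrFun hk (⟨x, hx⟩, a, b, 0)
  have h4 := congrArg (fun f => f.val ⟨chartAt V x y, Metric.ball_subset_closedBall h2⟩) h3
  have h5 := DFunLike.congr_fun h4 Fin.elim0
  exact h5

end BallCover

/-! ### Metrizability, local convexity and completeness -/

section Instances

variable [FiniteDimensional ℂ V] [CompactSpace X]
  [FiniteDimensional ℂ F] [IsManifold 𝓘(ℂ, V) ω X] [ContMDiffVectorBundle ω F E 𝓘(ℂ, V)]

instance : IsTopologicalAddGroup (SmoothSections V F E) :=
  (nonempty_ballCover V F E).elim fun C => by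
    rw [C.isInducing_coeffMap.eq_induced]; exact topologicalAddGroup_induced C.coeffMap

instance : ContinuousSMul ℝ (SmoothSections V F E) :=
  (nonempty_ballCover V F E).elim fun C => by
    rw [C.isInducing_coeffMap.eq_induced]; exact continuousSMul_induced C.coeffMap

instance : LocallyConvexSpace ℝ (SmoothSections V F E) :=
  (nonempty_ballCover V F E).elim fun C => C.isInducing_coeffMap.locallyConvexSpace

instance : TopologicalSpace.MetrizableSpace (SmoothSections V F E) :=
  (nonempty_ballCover V F E).elim fun C => 
    (⟨C.isInducing_coeffMap, C.injective_coeffMap⟩ :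
      Topology.IsEmbedding C.coeffMap).metrizableSpace

theorem exists_tendstoUniformlyOn_of_cauchySeq
    {u : ℕ → SmoothSections V F E}
    (hu : ∀ i : CoeffIndex V F E, CauchySeq fun j => coeffMap i (u j))
    (x₀ : X) (ξ η : F →L[ℂ] ℂ) (n : ℕ) :
    ∃ g : V → V [×n]→L[ℝ] ℂ, ∀ K : Set V, IsCompact K → K ⊆ localDomain V F E x₀ →
      TendstoUniformlyOn (fun j => iteratedFDeriv ℝ n (localCoeff V x₀ ξ η (u j).val)) g atTop
        K := by
  have key : ∀ K : Set V, IsCompact K → K ⊆ localDomain V F E x₀ → ∃ G : V → V [×n]→L[ℝ] ℂ,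
      TendstoUniformlyOn (fun j => iteratedFDeriv ℝ n (localCoeff V x₀ ξ η (u j).val)) G atTop
        K := by
    classical
    intro K hK hKd
    let i : CoeffIndex V F E := ⟨x₀, ξ, η, n, ⟨K, hK⟩, hKd⟩
    obtain ⟨G, hG⟩ := cauchySeq_tendsto_of_complete (hu i)
    rw [CoeffSpace.tendsto_iff_tendstoUniformly] at hG
    refine ⟨fun z => if h : z ∈ K then G.val ⟨z, h⟩ else 0, ?_⟩
    rw [tendstoUniformlyOn_iff_tendstoUniformly_comp_coe]
    have h : (fun z => if h : z ∈ K then G.val ⟨z, h⟩ else 0) ∘ ((↑) : K → V) = G.val :=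
      funext fun z => dif_pos z.2
    rw [h]
    exact hG
  -- The limits on different compact sets are glued through their pointwise values, which do not
  -- depend on the compact set.
  have hpt : ∀ z ∈ localDomain V F E x₀, ∃ y, Tendsto
      (fun j => iteratedFDeriv ℝ n (localCoeff V x₀ ξ η (u j).val) z) atTop (𝓝 y) := by
    intro z hz
    obtain ⟨G, hG⟩ := key {z} isCompact_singleton (singleton_subset_iff.2 hz)
    exact ⟨G z, hG.tendsto_at rfl⟩
  choose! g hg using hpt
  refine ⟨g, fun K hK hKd => ?_⟩
  obtain ⟨G, hG⟩ := key K hK hKd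
  exact hG.uniformCauchySeqOn.tendstoUniformlyOn_of_tendsto fun z hz => hg z (hKd hz)

theorem exists_tendsto_of_cauchySeq_coeffMap {u : ℕ → SmoothSections V F E}
    (hu : ∀ i : CoeffIndex V F E, CauchySeq fun j => coeffMap i (u j)) :
    ∃ k, Tendsto u atTop (𝓝 k) := by
  have := FiniteDimensional.proper ℂ V
  choose g hg using exists_tendstoUniformlyOn_of_cauchySeq hu
  have hloc : ∀ x₀ ξ η n, TendstoLocallyUniformlyOn
      (fun j => iteratedFDeriv ℝ n (localCoeff V x₀ ξ η (u j).val)) (g x₀ ξ η n) atTop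
      (localDomain V F E x₀) := fun x₀ ξ η n =>
    (tendstoLocallyUniformlyOn_iff_forall_isCompact (isOpen_localDomain V F E x₀)).2
      fun K hKd hK => hg x₀ ξ η n K hK hKd
  have hval : ∀ x₀ ξ η, ∀ z ∈ localDomain V F E x₀, Tendsto
      (fun j => localCoeff V x₀ ξ η (u j).val z) atTop
      (𝓝 (g x₀ ξ η 0 z (0 : Fin 0 → V))) := fun x₀ ξ η z hz =>
    ((ContinuousMultilinearMap.apply ℝ (fun _ : Fin 0 => V) ℂ 0).continuous.tendsto _).comp
      ((hloc x₀ ξ η 0).tendsto_at hz)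
  -- The limit section is assembled at each x in the coordinates centered at x. As `hk` shows that
  -- all tensor forms on each fiber converge, its coefficients in any other coordinates are again
  -- limits of those of u_j.
  let k : ∀ x, E x ⊗[ℂ] Conj (E x) := fun x => ∑ a, ∑ b,
    (g x (fiberForm F a) (fiberForm F b) 0 (chartAt V x x) (0 : Fin 0 → V)) •
      (fiberBasis (FiberBundle.mem_baseSet_trivializationAt F E x) a ⊗ₜ[ℂ]
        toConj (fiberBasis (FiberBundle.mem_baseSet_trivializationAt F E x) b))
  have hk : ∀ (x : X) (ξ η : E x →ₗ[ℂ] ℂ), Tendsto (fun j => tensorForm ξ η ((u j).val x)) atTop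
      (𝓝 (tensorForm ξ η (k x))) := by
    intro x ξ η
    have h1 : ∀ j, tensorForm ξ η ((u j).val x) = _ := fun j =>
      tensorForm_eq_sum_localCoeff (mem_chart_source V x)
        (FiberBundle.mem_baseSet_trivializationAt F E x) ξ η _
    simp only [h1, k, map_sum, map_smul, tensorForm_tmul, smul_eq_mul]
    exact tendsto_finsetSum _ fun a _ => tendsto_finsetSum _ fun b _ =>
      (hval x _ _ _ (chartAt_mem_localDomain V F E x)).mul_const _
  have hcd := fun x₀ ξ η => contDiffOn_of_tendstoLocallyUniformlyOn_iteratedFDeriv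
    (isOpen_localDomain V F E x₀) (fun j => (u j).contDiffOn x₀ ξ η) (hloc x₀ ξ η)
    (h := localCoeff V x₀ ξ η k) (fun z _ => hk _ _ _)
  let k' : SmoothSections V F E := ⟨k, fun x₀ ξ η => (hcd x₀ ξ η).1⟩
  refine ⟨k', ?_⟩
  obtain ⟨C⟩ := nonempty_ballCover V F E
  rw [C.isInducing_coeffMap.tendsto_nhds_iff, tendsto_pi_nhds]
  intro j
  refine CoeffSpace.tendsto_iff_tendstoUniformly.2 ?_
  have h := hg _ (C.coeffIndex j).left (C.coeffIndex j).right (C.coeffIndex j).order _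
    (C.coeffIndex j).compacts.isCompact (C.coeffIndex j).subset
  have h2 := h.congr_right ((hcd _ _ _).2 _ |>.symm.mono (C.coeffIndex j).subset)
  exact tendstoUniformlyOn_iff_tendstoUniformly_comp_coe.1 h2

theorem isFrechetSpace_smoothSections : IsFrechetSpace (SmoothSections V F E) where
  isTopologicalAddGroup := inferInstance
  continuousSMul := inferInstance
  locallyConvexSpace := inferInstance
  metrizableSpace := inferInstance
  complete := by
    let _ : UniformSpace (SmoothSections V F E) := IsTopologicalAddGroup.rightUniformSpace _
    have : IsUniformAddGroup (SmoothSections V F E) := isUniformAddGroup_of_addCommGroup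
    -- By metrizability the uniformity is countably generated, so completeness can be tested on
    -- sequences. Continuous linear maps take these to Cauchy sequences in the Banach spaces.
    have : (uniformity (SmoothSections V F E)).IsCountablyGenerated :=
      IsUniformAddGroup.uniformity_countably_generated
    refine UniformSpace.complete_of_cauchySeq_tendsto fun u hu =>
      exists_tendsto_of_cauchySeq_coeffMap fun i => ?_
    exact (uniformContinuous_addMonoidHom_of_continuous
      (f := (coeffMap i).toAddMonoidHom) (continuous_coeffMap i)).comp_cauchySeq hu

end Instances

end Frechet

/-! ### Polarization -/

/-- A sum of products of holomorphic and antiholomorphic functions that vanishes on the diagonal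
vanishes identically. -/
theorem sum_mul_conj_eq_zero_of_diagonal {V : Type*} [NormedAddCommGroup V] [NormedSpace ℂ V]
    {ι : Type*} (s : Finset ι) {c : V} {r : ℝ} {f g : ι → V → ℂ}
    (hf : ∀ i ∈ s, DifferentiableOn ℂ (f i) (Metric.ball c r))
    (hg : ∀ i ∈ s, DifferentiableOn ℂ (g i) (Metric.ball c r))
    (h : ∀ z ∈ Metric.ball c r, ∑ i ∈ s, f i z * conj (g i z) = 0) {p q : V}
    (hp : p ∈ Metric.ball c r) (hq : q ∈ Metric.ball c r) :
    ∑ i ∈ s, f i p * conj (g i q) = 0 := by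
  -- The vectors solve m + iu = p and m - iu = q. Thus the pair (m + ζu, m + ζ̄u) is (p, q) at ζ = i
  -- and lies on the diagonal for real ζ.
  set m : V := (2⁻¹ : ℂ) • (p + q) with hm
  set u : V := (-(Complex.I / 2)) • (p - q) with hu
  have hpu : m + Complex.I • u = p := by
    rw [hm, hu, smul_smul, show Complex.I * -(Complex.I / 2) = 2⁻¹ by
      linear_combination (-(1 : ℂ) / 2) * Complex.I_mul_I]
    module
  have hqu : m + conj Complex.I • u = q := by
    rw [hm, hu, smul_smul, Complex.conj_I, show -Complex.I * -(Complex.I / 2) = -2⁻¹ by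
      linear_combination ((1 : ℂ) / 2) * Complex.I_mul_I]
    module
  let D₁ : Set ℂ := (fun ζ => m + ζ • u) ⁻¹' Metric.ball c r
  let D₂ : Set ℂ := (fun ζ => m + conj ζ • u) ⁻¹' Metric.ball c r
  have hD₁ : IsOpen D₁ := Metric.isOpen_ball.preimage (by fun_prop)
  have hD₂ : IsOpen D₂ := Metric.isOpen_ball.preimage
    (continuous_const.add (Complex.continuous_conj.smul continuous_const))
  have hconv₁ : Convex ℝ D₁ := by
    intro ζ₁ h₁ ζ₂ h₂ a b ha hb hab
    have h3 := convex_ball c r h₁ h₂ ha hb hab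
    have h4 : (a • ζ₁ + b • ζ₂) • u = a • ζ₁ • u + b • ζ₂ • u := by
      rw [add_smul, smul_assoc, smul_assoc]
    have h5 : a • m + b • m = m := by rw [← add_smul, hab, one_smul]
    rw [mem_preimage, h4]
    convert h3 using 1
    rw [smul_add, smul_add, add_add_add_comm, h5]
  have hconv₂ : Convex ℝ D₂ := by
    have h : D₂ = (Complex.conjLIE.toLinearEquiv : ℂ →ₗ[ℝ] ℂ) ⁻¹' D₁ := rfl
    rw [h]; exact hconv₁.linear_preimage _
  have hD : IsOpen (D₁ ∩ D₂) := hD₁.inter hD₂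
  -- This is holomorphic in ζ because conjugation occurs both inside and outside each g_i.
  set F : ℂ → ℂ := fun ζ => ∑ i ∈ s, f i (m + ζ • u) * conj (g i (m + conj ζ • u)) with hF
  have hFd : DifferentiableOn ℂ F (D₁ ∩ D₂) := by
    refine DifferentiableOn.fun_sum fun i hi => DifferentiableOn.mul ?_ ?_
    · exact (hf i hi).comp (by fun_prop) (fun ζ hζ => hζ.1)
    · intro ζ hζ
      have h1 : DifferentiableAt ℂ (fun ζ => g i (m + ζ • u)) (conj ζ) := by
        refine DifferentiableAt.comp (conj ζ)
          ((hg i hi).differentiableAt (Metric.isOpen_ball.mem_nhds hζ.2)) (by fun_prop)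
      exact (differentiableAt_conj_conj_iff.2 h1).differentiableWithinAt
  have h0 : (0 : ℂ) ∈ D₁ ∩ D₂ := by
    have : m ∈ Metric.ball c r := by
      have := convex_ball c r hp hq (by norm_num : (0 : ℝ) ≤ 2⁻¹) (by norm_num : (0 : ℝ) ≤ 2⁻¹)
        (by norm_num)
      convert this using 1
      rw [hm, ← Complex.coe_smul, ← Complex.coe_smul, ← smul_add]
      norm_num
    simpa [D₁, D₂] using this
  have hI : Complex.I ∈ D₁ ∩ D₂ := by
    constructor
    · rw [mem_preimage, hpu]; exact hp
    · rw [mem_preimage, hqu]; exact hq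
  -- F vanishes at real ζ near 0. The identity theorem on the convex set `D₁ ∩ D₂` carries this to ζ
  -- = i.
  have hfreq : ∃ᶠ ζ in 𝓝[≠] (0 : ℂ), F ζ = 0 := by
    have ht : Tendsto (fun t : ℝ => (t : ℂ)) (𝓝[≠] 0) (𝓝[≠] 0) := by
      refine tendsto_nhdsWithin_iff.2 ⟨?_, ?_⟩
      · exact (Complex.continuous_ofReal.tendsto' 0 0 rfl).mono_left nhdsWithin_le_nhds
      · filter_upwards [self_mem_nhdsWithin] with t ht using by simpa using ht
    have hev : ∀ᶠ ζ in 𝓝[≠] (0 : ℂ), ζ ∈ D₁ ∩ D₂ := nhdsWithin_le_nhds (hD.mem_nhds h0)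
    refine ht.frequently (Eventually.frequently ?_)
    filter_upwards [ht.eventually hev] with t htD
    rw [hF]
    simp only [Complex.conj_ofReal]
    exact h _ htD.1
  have := (hFd.analyticOnNhd hD).eqOn_zero_of_preconnected_of_frequently_eq_zero
    (hconv₁.inter hconv₂).isPreconnected h0 hfreq hI
  rw [hF] at this
  simpa only [hpu, hqu, Pi.zero_apply] using this

/-! ### Holomorphic sections -/

section Holomorphic

variable {V : Type*} [NormedAddCommGroup V] [NormedSpace ℂ V]
  {X : Type*} [TopologicalSpace X] [ChartedSpace V X]
  {F : Type*} [NormedAddCommGroup F] [NormedSpace ℂ F]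
  {E : X → Type*} [∀ x, AddCommGroup (E x)] [∀ x, Module ℂ (E x)]
  [∀ x, TopologicalSpace (E x)] [TopologicalSpace (TotalSpace F E)]
  [FiberBundle F E] [VectorBundle ℂ F E]

/-- The representation of a section in the coordinates at `x₀`. -/
noncomputable def localRep (x₀ : X) (s : ∀ x, E x) (z : V) : F :=
  (trivializationAt F E x₀).linearMapAt ℂ ((chartAt V x₀).symm z) (s ((chartAt V x₀).symm z))

theorem localRep_chart {x₀ x : X} (hx : x ∈ (chartAt V x₀).source) (s : ∀ x, E x) :
    localRep x₀ s (chartAt V x₀ x) = (trivializationAt F E x₀).linearMapAt ℂ x (s x) := by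
  rw [localRep, (chartAt V x₀).left_inv hx]

theorem eq_zero_of_localRep_eq_zero {x₀ x : X} (hx : x ∈ (chartAt V x₀).source)
    (hx' : x ∈ (trivializationAt F E x₀).baseSet) {s : ∀ x, E x}
    (h : (localRep x₀ s (chartAt V x₀ x) : F) = 0) : s x = 0 := by
  rw [localRep_chart hx] at h
  have := (trivializationAt F E x₀).symmₗ_linearMapAt (R := ℂ) hx' (s x)
  rw [← this, h, map_zero]

theorem localRep_sum {ι : Type*} (x₀ : X) (I : Finset ι) (a : ι → ℂ)
    (w : ι → HolomorphicSections V F E) (z : V) :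
    (localRep x₀ (⇑(∑ i ∈ I, a i • w i)) z : F) = ∑ i ∈ I, a i • localRep x₀ (w i) z := by
  have h : ⇑(∑ i ∈ I, a i • w i) = ∑ i ∈ I, a i • ⇑(w i) := by
    induction I using Finset.cons_induction with
    | empty => simp
    | cons i I hi ih => rw [Finset.sum_cons, Finset.sum_cons, ContMDiffSection.coe_add, ih]; rfl
  rw [h, localRep, Finset.sum_apply, map_sum]
  refine Finset.sum_congr rfl fun i _ => ?_
  rw [Pi.smul_apply, map_smul]
  rfl

variable [IsManifold 𝓘(ℂ, V) ω X] [ContMDiffVectorBundle ω F E 𝓘(ℂ, V)]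

theorem contDiffOn_localRep (x₀ : X) (s : HolomorphicSections V F E) :
    ContDiffOn ℂ ω (localRep x₀ s : V → F) (localDomain V F E x₀) := by
  set e := trivializationAt F E x₀ with he
  have h1 : ContMDiffOn 𝓘(ℂ, V) 𝓘(ℂ, F) ω (fun x => (e ⟨x, s x⟩).2) e.baseSet :=
    (e.contMDiffOn_section_baseSet_iff (IB := 𝓘(ℂ, V)) (n := ω)).1 s.contMDiff.contMDiffOn
  have h2 : ContMDiffOn 𝓘(ℂ, V) 𝓘(ℂ, F) ω
      (fun z => (e ⟨(chartAt V x₀).symm z, s ((chartAt V x₀).symm z)⟩).2)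
      (localDomain V F E x₀) :=
    h1.comp (contMDiffOn_chart_symm_localDomain x₀) (fun z hz => hz.2)
  refine h2.contDiffOn.congr fun z hz => ?_
  have hz' : (chartAt V x₀).symm z ∈ (trivializationAt F E x₀).baseSet := hz.2
  rw [localRep, Trivialization.linearMapAt_apply, if_pos hz']

theorem analyticOnNhd_localRep (x₀ : X) (s : HolomorphicSections V F E) :
    AnalyticOnNhd ℂ (localRep x₀ s : V → F) (localDomain V F E x₀) :=
  ((isOpen_localDomain V F E x₀).analyticOn_iff_analyticOnNhd).1 (contDiffOn_localRep x₀ s).analyticOn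

theorem differentiableOn_localRep (x₀ : X) (s : HolomorphicSections V F E) (ξ : F →L[ℂ] ℂ) :
    DifferentiableOn ℂ (fun z => ξ (localRep x₀ s z)) (localDomain V F E x₀) :=
  ξ.differentiable.comp_differentiableOn (analyticOnNhd_localRep x₀ s).differentiableOn

theorem tmul_mem_smoothSections (s t : HolomorphicSections V F E) :
    (fun x => s x ⊗ₜ[ℂ] toConj (t x)) ∈ smoothSections V F E := by
  intro x₀ ξ η
  have h (s : HolomorphicSections V F E) (ξ : F →L[ℂ] ℂ) : ContDiffOn ℝ ∞
      (fun z => ξ (localRep x₀ s z)) (localDomain V F E x₀) :=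
    (ξ.restrictScalars ℝ).contDiff.comp_contDiffOn
      (((contDiffOn_localRep x₀ s).restrict_scalars ℝ).of_le le_top)
  exact (h s ξ).mul (Complex.conjCLE.contDiff.comp_contDiffOn (h t η))

/-- The smooth section `x ↦ s(x) ⊗ t(x)` of `E ⊗ Ē`. -/
noncomputable def tmulSection (s t : HolomorphicSections V F E) : SmoothSections V F E :=
  ⟨fun x => s x ⊗ₜ[ℂ] toConj (t x), tmul_mem_smoothSections s t⟩

theorem tmulSection_val (s t : HolomorphicSections V F E) (x : X) :
    (tmulSection s t).val x = s x ⊗ₜ[ℂ] toConj (t x) := rfl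

/-- The identity theorem for holomorphic sections. -/
theorem holomorphicSection_eq_zero_of_eventually [PreconnectedSpace X]
    {s : HolomorphicSections V F E} {x₀ : X} (h : ∀ᶠ x in 𝓝 x₀, s x = 0) : s = 0 := by
  let Z : Set X := {x | ∀ᶠ y in 𝓝 x, s y = 0}
  have hZo : IsOpen Z := isOpen_setOfPred_eventually_nhds
  -- At a limit point x, a ball in the coordinates at x meets `Z`. The representation of s vanishes
  -- near one point of the ball, hence on the whole ball.
  have hZc : IsClosed Z := by
    refine isClosed_of_closure_subset fun x hx => ?_
    obtain ⟨r, hr, hr'⟩ := Metric.isOpen_iff.1 (isOpen_localDomain V F E x) _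
      (chartAt_mem_localDomain V F E x)
    have hN : (chartAt V x).source ∩ chartAt V x ⁻¹' Metric.ball (chartAt V x x) r ∈ 𝓝 x :=
      ((chartAt V x).isOpen_inter_preimage Metric.isOpen_ball).mem_nhds
        ⟨mem_chart_source V x, Metric.mem_ball_self hr⟩
    obtain ⟨y, ⟨hy1, hy2⟩, hyZ⟩ := mem_closure_iff_nhds.1 hx _ hN
    have hev : localRep x s =ᶠ[𝓝 (chartAt V x y)] (0 : V → F) := by
      have ht : Tendsto (chartAt V x).symm (𝓝 (chartAt V x y)) (𝓝 y) := by
        have := (chartAt V x).continuousAt_symm ((chartAt V x).map_source hy1)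
        rwa [ContinuousAt, (chartAt V x).left_inv hy1] at this
      filter_upwards [ht.eventually hyZ] with z hz
      rw [localRep, hz, map_zero, Pi.zero_apply]
    have hzero := ((analyticOnNhd_localRep x s).mono
      hr').eqOn_zero_of_preconnected_of_eventuallyEq_zero
      (convex_ball (chartAt V x x) r).isPreconnected hy2 hev
    refine mem_of_superset hN fun x' hx' => ?_
    have hb := (hr' hx'.2).2
    rw [mem_preimage, (chartAt V x).left_inv hx'.1] at hb
    exact eq_zero_of_localRep_eq_zero hx'.1 hb (hzero hx'.2)
  have hZ : Z = univ := IsClopen.eq_univ ⟨hZc, hZo⟩ ⟨x₀, h⟩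
  refine ContMDiffSection.ext fun x => ?_
  have hx : x ∈ Z := hZ ▸ mem_univ x
  exact hx.self_of_nhds

theorem holomorphicSection_eq_zero_of_localRep [PreconnectedSpace X]
    {s : HolomorphicSections V F E} {x₀ : X} {r : ℝ} (hr : 0 < r)
    (hr' : Metric.ball (chartAt V x₀ x₀) r ⊆ localDomain V F E x₀)
    (h : ∀ ξ : F →L[ℂ] ℂ, ∀ z ∈ Metric.ball (chartAt V x₀ x₀) r, ξ (localRep x₀ s z) = 0) :
    s = 0 := by
  refine holomorphicSection_eq_zero_of_eventually (x₀ := x₀) ?_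
  filter_upwards [((chartAt V x₀).isOpen_inter_preimage Metric.isOpen_ball).mem_nhds
        ⟨mem_chart_source V x₀, Metric.mem_ball_self hr⟩] with x hx
  have hb := (hr' hx.2).2
  rw [mem_preimage, (chartAt V x₀).left_inv hx.1] at hb
  exact eq_zero_of_localRep_eq_zero hx.1 hb (SeparatingDual.eq_zero_of_forall_dual_eq_zero (R := ℂ)
    fun ξ => h ξ _ hx.2)

/-- The map `W ⊗ W̄ → C^∞(E ⊗ Ē)`, `W = 𝒪(E)`, is injective. -/
theorem eq_zero_of_sum_tmulSection_eq_zero [ConnectedSpace X] {ι : Type*} [Fintype ι]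
    {w : ι → HolomorphicSections V F E} (hw : LinearIndependent ℂ w) {a : ι → ι → ℂ}
    (h : ∑ i, ∑ j, a i j • tmulSection (w i) (w j) = 0) : a = 0 := by
  obtain ⟨x₀⟩ := (inferInstance : Nonempty X)
  obtain ⟨r, hr, hr'⟩ := Metric.isOpen_iff.1 (isOpen_localDomain V F E x₀) _
      (chartAt_mem_localDomain V F E x₀)
  have hd : ∀ i (ξ : F →L[ℂ] ℂ), DifferentiableOn ℂ (fun z => ξ (localRep x₀ (w i) z))
      (Metric.ball (chartAt V x₀ x₀) r) := fun i ξ => (differentiableOn_localRep x₀ (w i) ξ).mono hr'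
  have hdiag : ∀ (ξ η : F →L[ℂ] ℂ), ∀ z ∈ Metric.ball (chartAt V x₀ x₀) r,
      ∑ p : ι × ι, (a p.1 p.2 * ξ (localRep x₀ (w p.1) z)) * conj (η (localRep x₀ (w p.2) z)) =
        0 := by
    intro ξ η z hz
    have h1 : ∑ i, ∑ j, a i j • (w i ((chartAt V x₀).symm z) ⊗ₜ[ℂ]
        toConj (w j ((chartAt V x₀).symm z))) = 0 := by
      have := congrArg (fun k => SmoothSections.val k ((chartAt V x₀).symm z)) h
      simp only [SmoothSections.val_sum] at this
      exact this
    have h2 := congrArg (tensorForm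
      ((ξ : F →ₗ[ℂ] ℂ) ∘ₗ (trivializationAt F E x₀).linearMapAt ℂ ((chartAt V x₀).symm z))
      ((η : F →ₗ[ℂ] ℂ) ∘ₗ (trivializationAt F E x₀).linearMapAt ℂ ((chartAt V x₀).symm z))) h1
    simp only [map_sum, map_smul, tensorForm_tmul, map_zero, smul_eq_mul] at h2
    rw [Fintype.sum_prod_type]
    simp only [mul_assoc]
    exact h2
  -- Polarization, applied to the sum over pairs (i, j), separates the two variables.
  have hpol : ∀ (ξ η : F →L[ℂ] ℂ), ∀ z ∈ Metric.ball (chartAt V x₀ x₀) r,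
      ∀ z' ∈ Metric.ball (chartAt V x₀ x₀) r,
      ∑ i, ξ (localRep x₀ (w i) z) * (∑ j, a i j * conj (η (localRep x₀ (w j) z'))) = 0 := by
    intro ξ η z hz z' hz'
    have := sum_mul_conj_eq_zero_of_diagonal Finset.univ (fun p _ => (hd p.1 ξ).const_mul _)
      (fun p _ => hd p.2 η) (hdiag ξ η) hz hz'
    rw [Fintype.sum_prod_type] at this
    rw [← this]
    refine Finset.sum_congr rfl fun i _ => ?_
    rw [Finset.mul_sum]
    exact Finset.sum_congr rfl fun j _ => by ring
  -- By the identity theorem, independence of the sections is already visible on the ball. It is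
  -- used twice: in z, and then in z' after conjugation.
  have hlin : ∀ c : ι → ℂ, (∀ ξ : F →L[ℂ] ℂ, ∀ z ∈ Metric.ball (chartAt V x₀ x₀) r,
      ∑ i, c i * ξ (localRep x₀ (w i) z) = 0) → ∀ i, c i = 0 := by
    intro c hc
    refine Fintype.linearIndependent_iff.1 hw c ?_
    refine holomorphicSection_eq_zero_of_localRep hr hr' fun ξ z hz => ?_
    rw [localRep_sum, map_sum]
    simpa only [map_smul, smul_eq_mul] using hc ξ z hz
  have h3 : ∀ (η : F →L[ℂ] ℂ), ∀ z ∈ Metric.ball (chartAt V x₀ x₀) r, ∀ i,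
      ∑ j, a i j * conj (η (localRep x₀ (w j) z)) = 0 := by
    intro η z' hz'
    refine hlin _ fun ξ z hz => ?_
    simpa only [mul_comm] using hpol ξ η z hz z' hz'
  ext i j
  have h4 := hlin (fun j => conj (a i j)) (fun η z hz => by
    have := congrArg conj (h3 η z hz i)
    simpa only [map_sum, map_mul, Complex.conj_conj, map_zero] using this) j
  simpa using h4

/-! ### Finite dimensionality of the space of holomorphic sections -/

section FiniteDimensional

variable [FiniteDimensional ℂ F]

/-- On the larger balls of the cover, holomorphic sections are bounded by a multiple of a bound on
the smaller balls. -/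
theorem BallCover.exists_norm_localRep_le [FiniteDimensional ℂ V] (C : BallCover V F E) (x₀ : X)
    (ξ : F →L[ℂ] ℂ) :
    ∃ A : ℝ, 0 ≤ A ∧ ∀ (s : HolomorphicSections V F E) (B : ℝ), 0 ≤ B →
      (∀ x ∈ C.centers, ∀ a, ∀ w ∈ Metric.closedBall (chartAt V x x) (C.radius x),
        ‖fiberForm F a (localRep x s w)‖ ≤ B) →
      ∀ z ∈ Metric.closedBall (chartAt V x₀ x₀) (2 * C.radius x₀),
        ‖ξ (localRep x₀ s z)‖ ≤ A * B := by
  have := FiniteDimensional.proper ℂ V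
  -- The estimate for E ⊗ Ē is applied to s ⊗ s with equal forms and order 0. The coefficient is
  -- then |ξ(s)|², which explains the square root of the constant.
  obtain ⟨A, hA, h⟩ := C.exists_norm_iteratedFDeriv_localCoeff_le x₀ ξ ξ 0
    (isCompact_closedBall (chartAt V x₀ x₀) (2 * C.radius x₀)) (C.closedBall_subset x₀)
  refine ⟨√A, Real.sqrt_nonneg A, fun s B hB hs z hz => ?_⟩
  have h1 := h (tmulSection s s).val (tmulSection s s).2 (B ^ 2) (by positivity)
    (fun x hx a b m hm w hw => by
      obtain rfl : m = 0 := by omega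
      rw [norm_iteratedFDeriv_zero]
      change ‖fiberForm F a (localRep x s w) * conj (fiberForm F b (localRep x s w))‖ ≤ B ^ 2
      rw [norm_mul, RCLike.norm_conj, sq]
      exact mul_le_mul (hs x hx a w hw) (hs x hx b w hw) (norm_nonneg _) hB) z hz
  rw [norm_iteratedFDeriv_zero] at h1
  change ‖ξ (localRep x₀ s z) * conj (ξ (localRep x₀ s z))‖ ≤ A * B ^ 2 at h1
  rw [norm_mul, RCLike.norm_conj, ← sq] at h1
  have h2 := Real.sqrt_le_sqrt h1
  rwa [Real.sqrt_sq (norm_nonneg _), Real.sqrt_mul hA, Real.sqrt_sq hB] at h2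

/-- There is a finite set of points such that a holomorphic section that vanishes there is
determined to be small. -/
theorem BallCover.exists_finset_norm_localRep_le [FiniteDimensional ℂ V] (C : BallCover V F E)
    (x₀ : X) (ξ : F →L[ℂ] ℂ) :
    ∃ T : Finset V, ∀ (s : HolomorphicSections V F E), (∀ t ∈ T, ξ (localRep x₀ s t) = 0) →
      ∀ B : ℝ, 0 ≤ B →
      (∀ x ∈ C.centers, ∀ a, ∀ w ∈ Metric.closedBall (chartAt V x x) (C.radius x),
        ‖fiberForm F a (localRep x s w)‖ ≤ B) →
      ∀ z ∈ Metric.closedBall (chartAt V x₀ x₀) (C.radius x₀), ‖ξ (localRep x₀ s z)‖ ≤ B / 2 := by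
  have := FiniteDimensional.proper ℂ V
  obtain ⟨A, hA, h⟩ := C.exists_norm_localRep_le x₀ ξ
  have hr := C.radius_pos x₀
  set r := C.radius x₀ with hr_def
  -- The mesh is chosen so that the Schwarz bound AB/r times the distance is at most AB/(4(A + 1)) ≤
  -- B/2; adding 1 keeps the denominator positive when A = 0.
  obtain ⟨T, hT, hTf, hTc⟩ := (isCompact_closedBall (chartAt V x₀ x₀) r).finite_cover_balls
    (e := r / (4 * (A + 1))) (by positivity)
  refine ⟨hTf.toFinset, fun s hs B hB hsB z hz => ?_⟩
  obtain ⟨t, ht, hzt⟩ := mem_iUnion₂.1 (hTc hz)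
  -- This is why the cover leaves room for balls of twice the radius: the Schwarz lemma is applied
  -- on a ball of radius r about a point t of the smaller ball.
  have hsub : Metric.ball t r ⊆ Metric.closedBall (chartAt V x₀ x₀) (2 * r) := by
    intro y hy
    have h1 := Metric.mem_ball.1 hy
    have h2 := Metric.mem_closedBall.1 (hT ht)
    exact Metric.mem_closedBall.2 ((dist_triangle _ t _).trans (by linarith))
  have hst := hs t (hTf.mem_toFinset.2 ht)
  have hA1 : r / (4 * (A + 1)) ≤ r := div_le_self hr.le (by linarith)
  have hdist := Complex.dist_le_div_mul_dist_of_mapsTo_ball (f := fun z => ξ (localRep x₀ s z))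
    (c := t) (z := z) (R₁ := r) (R₂ := A * B)
    ((differentiableOn_localRep x₀ s ξ).mono (hsub.trans (C.closedBall_subset x₀)))
    (fun y hy => by
      rw [hst, mem_closedBall_zero_iff]
      exact h s B hB hsB y (hsub hy))
    (Metric.ball_subset_ball hA1 hzt)
  rw [hst, dist_zero_right] at hdist
  refine hdist.trans ?_
  have h1 : dist z t ≤ r / (4 * (A + 1)) := (Metric.mem_ball.1 hzt).le
  calc A * B / r * dist z t ≤ A * B / r * (r / (4 * (A + 1))) := by gcongr
    _ = (A / (4 * (A + 1))) * B := by field_simp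
    _ ≤ (1 / 2) * B := by
      have h2 : A / (4 * (A + 1)) ≤ 1 / 2 := by
        rw [div_le_div_iff₀ (by positivity) two_pos]
        linarith
      exact mul_le_mul_of_nonneg_right h2 hB
    _ = B / 2 := by ring

variable (V F E) in
-- Evaluation at the finitely many points of the sets `T p` is injective: for a section in its
-- kernel, every bound on the balls of the cover can be halved, so the section is 0.
theorem finiteDimensional_holomorphicSections [FiniteDimensional ℂ V] [CompactSpace X] :
    FiniteDimensional ℂ (HolomorphicSections V F E) := by
  have := FiniteDimensional.proper ℂ V
  obtain ⟨C⟩ := nonempty_ballCover V F E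
  choose T hT using fun p : C.centers × Fin (Module.finrank ℂ F) =>
    C.exists_finset_norm_localRep_le (p.1 : X) (fiberForm F p.2)
  let L : HolomorphicSections V F E →ₗ[ℂ] ((q : Σ p, T p) → ℂ) :=
    { toFun := fun s q => fiberForm F q.1.2 (localRep (q.1.1 : X) s q.2.1)
      map_add' := fun s t => by
        ext q
        simp only [localRep, ContMDiffSection.coe_add, Pi.add_apply, map_add]
      map_smul' := fun c s => by
        ext q
        simp only [localRep, ContMDiffSection.coe_smul, Pi.smul_apply, map_smul, RingHom.id_apply] }
  refine FiniteDimensional.of_injective L ((injective_iff_map_eq_zero L).2 fun s hs => ?_)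
  have hs0 : ∀ p, ∀ t ∈ T p, fiberForm F p.2 (localRep (p.1 : X) s t) = 0 := fun p t ht =>
    congrFun (f := L s) hs (Sigma.mk p (Subtype.mk t ht))
  have hbdd : ∀ p : C.centers × Fin (Module.finrank ℂ F), ∃ B : ℝ,
      ∀ w ∈ Metric.closedBall (chartAt V p.1.1 p.1.1) (C.radius p.1),
        ‖fiberForm F p.2 (localRep (p.1 : X) s w)‖ ≤ B := fun p =>
    -- Compactness of the closed balls provides the finite bound from which the halving starts.
    (isCompact_closedBall _ _).exists_bound_of_continuousOn
      ((differentiableOn_localRep _ s _).continuousOn.mono (C.closedBall_subset' _))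
  choose B₀ hB₀ using hbdd
  set B : ℝ := ∑ p, |B₀ p| with hB
  have hB0 : 0 ≤ B := Finset.sum_nonneg fun p _ => abs_nonneg _
  have key : ∀ n : ℕ, ∀ x ∈ C.centers, ∀ a, ∀ w ∈ Metric.closedBall (chartAt V x x) (C.radius x),
      ‖fiberForm F a (localRep x s w)‖ ≤ B / 2 ^ n := by
    intro n
    induction n with
    | zero =>
      intro x hx a w hw
      rw [pow_zero, div_one]
      exact (hB₀ (⟨x, hx⟩, a) w hw).trans ((le_abs_self _).trans
        (Finset.single_le_sum (f := fun p => |B₀ p|) (fun p _ => abs_nonneg _)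
          (Finset.mem_univ _)))
    | succ n ih =>
      intro x hx a w hw
      rw [pow_succ, ← div_div]
      exact hT (⟨x, hx⟩, a) s (hs0 _) _ (by positivity) ih w hw
  have hlim : Tendsto (fun n : ℕ => B / 2 ^ n) atTop (𝓝 0) := by
    simpa [div_eq_mul_inv] using
      (tendsto_pow_atTop_nhds_zero_of_lt_one (r := (2⁻¹ : ℝ)) (by norm_num)
        (by norm_num)).const_mul B
  refine ContMDiffSection.ext fun y => ?_
  obtain ⟨x, hx, h1, h2⟩ := C.cover y
  refine eq_zero_of_localRep_eq_zero h1 (C.mem_baseSet h1 h2) ?_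
  refine (Module.finBasis ℂ F).ext_elem fun a => ?_
  have h3 := ge_of_tendsto' hlim fun n => key n x hx a _ (Metric.ball_subset_closedBall h2)
  rw [map_zero]
  exact norm_le_zero_iff.1 h3

end FiniteDimensional

end Holomorphic

open scoped ComplexOrder Matrix

/-! ### The matrix inverse -/

section MatrixInverse

variable {ι : Type*} [Fintype ι] [DecidableEq ι]

theorem _root_.ContDiff.matrix_det {V : Type*} [NormedAddCommGroup V] [NormedSpace ℝ V]
    {M : V → Matrix ι ι ℂ} (hM : ∀ i j, ContDiff ℝ ∞ fun v => M v i j) :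
    ContDiff ℝ ∞ fun v => (M v).det := by
  simp only [Matrix.det_apply']
  exact ContDiff.sum fun σ _ => contDiff_const.mul (contDiff_prod fun i _ => hM _ _)

/-- The transpose of the inverse matrix. -/
noncomputable def invTranspose (A : ι → ι → ℂ) : ι → ι → ℂ := fun i j => (Matrix.of A)⁻¹ j i

/-- Cramer's rule: each entry is a quotient of determinants, which are polynomial in the entries. -/
theorem contDiffOn_invTranspose :
    ContDiffOn ℝ ∞ (invTranspose (ι := ι)) {A | (Matrix.of A).det ≠ 0} := by
  have hc : ∀ i j, ContDiff ℝ ∞ fun A : ι → ι → ℂ => Matrix.of A i j := fun i j =>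
    (contDiff_apply_apply ℝ ℂ i j)
  refine contDiffOn_pi.2 fun i => contDiffOn_pi.2 fun j => ?_
  have h : ∀ A : ι → ι → ℂ, invTranspose A i j =
      (Matrix.of A).det⁻¹ * ((Matrix.of A).updateRow i (Pi.single j 1)).det := by
    intro A
    rw [invTranspose, Matrix.inv_def, Matrix.smul_apply, Matrix.adjugate_apply,
      Ring.inverse_eq_inv', smul_eq_mul]
  simp only [h]
  refine ((ContDiff.matrix_det hc).contDiffOn.inv fun A hA => hA).mul
    (ContDiff.matrix_det fun k l => ?_).contDiffOn
  rcases eq_or_ne k i with rfl | hk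
  · simp only [Matrix.updateRow_self]
    exact contDiff_const
  · simp only [Matrix.updateRow_ne hk]
    exact hc k l

theorem isOpen_det_ne_zero : IsOpen {A : ι → ι → ℂ | (Matrix.of A).det ≠ 0} :=
  isOpen_ne_fun (ContDiff.matrix_det fun i j => contDiff_apply_apply ℝ ℂ i j).continuous
    continuous_const

theorem of_invTranspose (A : ι → ι → ℂ) :
    Matrix.of (invTranspose A) = ((Matrix.of A)⁻¹)ᵀ := rfl

theorem posDef_invTranspose {A : ι → ι → ℂ} (hA : (Matrix.of A).PosDef) :
    (Matrix.of (invTranspose A)).PosDef := by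
  rw [of_invTranspose]; exact hA.inv.transpose

theorem invTranspose_invTranspose {A : ι → ι → ℂ} (hA : (Matrix.of A).det ≠ 0) :
    invTranspose (invTranspose A) = A := by
  apply Matrix.of.injective
  rw [of_invTranspose, of_invTranspose, ← Matrix.transpose_nonsing_inv, Matrix.transpose_transpose,
    Matrix.nonsing_inv_nonsing_inv _ (isUnit_iff_ne_zero.2 hA)]

end MatrixInverse

/-! ### Inner products and their Gram matrices -/

section Gram

variable {W : Type*} [AddCommGroup W] [Module ℂ W]

namespace InnerProducts

/-- `InnerProducts.val` as a linear map. -/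
noncomputable def valLinear : InnerProducts W →ₗ[ℝ] W → W → ℂ where
  toFun h := h.val
  map_add' _ _ := rfl
  map_smul' _ _ := rfl

theorem isInducing_valLinear : Topology.IsInducing (valLinear (W := W)) := ⟨rfl⟩

theorem ext {h h' : InnerProducts W} (H : ∀ s t, h.val s t = h'.val s t) : h = h' :=
  Subtype.ext (LinearMap.ext fun s => LinearMap.ext fun t => H s t)

theorem injective_valLinear : Function.Injective (valLinear (W := W)) := fun _ _ H =>
  ext fun s t => congrFun (congrFun H s) t

instance : IsTopologicalAddGroup (InnerProducts W) := topologicalAddGroup_induced valLinear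

instance : ContinuousSMul ℝ (InnerProducts W) := continuousSMul_induced valLinear

instance : LocallyConvexSpace ℝ (InnerProducts W) := isInducing_valLinear.locallyConvexSpace

instance : T2Space (InnerProducts W) :=
  (⟨isInducing_valLinear, injective_valLinear⟩ : Topology.IsEmbedding (valLinear (W := W))).t2Space

theorem continuous_val (s t : W) : Continuous fun h : InnerProducts W => h.val s t :=
  (continuous_apply t).comp ((continuous_apply s).comp isInducing_valLinear.continuous)

theorem val_conj (h : InnerProducts W) (s t : W) : conj (h.val t s) = h.val s t := (h.2 s t).symm

theorem val_sum_sum {ι κ : Type*} (h : InnerProducts W) (I : Finset ι) (J : Finset κ) (a : ι → ℂ)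
    (b : κ → ℂ) (w : ι → W) (v : κ → W) :
    h.val (∑ i ∈ I, a i • w i) (∑ j ∈ J, b j • v j) =
      ∑ i ∈ I, ∑ j ∈ J, a i * conj (b j) * h.val (w i) (v j) := by
  simp only [val, map_sum, map_smul, LinearMap.sum_apply, LinearMap.smul_apply, map_smulₛₗ,
    smul_eq_mul, Finset.mul_sum]
  rw [Finset.sum_comm]
  exact Finset.sum_congr rfl fun i _ => Finset.sum_congr rfl fun j _ => by ring

variable {ι : Type*} [Fintype ι] [DecidableEq ι] (w : Module.Basis ι ℂ W)

/-- The Gram matrix of an inner product with respect to a basis. -/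
noncomputable def gram : InnerProducts W →L[ℝ] (ι → ι → ℂ) where
  toFun h i j := h.val (w i) (w j)
  map_add' _ _ := rfl
  map_smul' _ _ := rfl
  cont := continuous_pi fun _ => continuous_pi fun _ => continuous_val _ _

theorem gram_apply (h : InnerProducts W) (i j : ι) : gram w h i j = h.val (w i) (w j) := rfl

theorem val_eq_sum_gram (h : InnerProducts W) (s t : W) :
    h.val s t = ∑ i, ∑ j, w.repr s i * conj (w.repr t j) * gram w h i j := by
  conv_lhs => rw [← w.sum_repr s, ← w.sum_repr t, val_sum_sum]
  rfl

theorem gram_injective : Function.Injective (gram w) := fun h h' H => ext fun s t => by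
  rw [val_eq_sum_gram w, val_eq_sum_gram w, H]

theorem isHermitian_gram (h : InnerProducts W) : (Matrix.of (gram w h)).IsHermitian := by
  ext i j
  exact h.val_conj _ _

theorem exists_gram_eq {A : ι → ι → ℂ} (hA : (Matrix.of A).IsHermitian) : ∃ h, gram w h = A := by
  let L : W →ₗ[ℂ] W →ₛₗ[starRingEnd ℂ] ℂ := LinearMap.mk₂'ₛₗ (RingHom.id ℂ) (starRingEnd ℂ)
    (fun s t => ∑ i, ∑ j, w.repr s i * conj (w.repr t j) * A i j)
    (fun s s' t => by simp only [map_add, Finsupp.add_apply, add_mul, Finset.sum_add_distrib])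
    (fun c s t => by
      simp only [map_smul, Finsupp.smul_apply, smul_eq_mul, Finset.mul_sum, mul_assoc,
        RingHom.id_apply])
    (fun s t t' => by
      simp only [map_add, Finsupp.add_apply, add_mul, mul_add, Finset.sum_add_distrib])
    (fun c s t => by
      simp only [map_smul, Finsupp.smul_apply, smul_eq_mul, Finset.mul_sum, map_mul]
      exact Finset.sum_congr rfl fun i _ => Finset.sum_congr rfl fun j _ => by ring)
  have hL : ∀ s t, L s t = ∑ i, ∑ j, w.repr s i * conj (w.repr t j) * A i j := fun s t => rfl
  have hAc : ∀ i j, conj (A i j) = A j i := fun i j => hA.apply j i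
  refine ⟨⟨L, fun s t => ?_⟩, ?_⟩
  · rw [hL, hL, Finset.sum_comm]
    simp only [map_sum, map_mul, Complex.conj_conj, hAc]
    exact Finset.sum_congr rfl fun i _ => Finset.sum_congr rfl fun j _ => by ring
  · funext i j
    change L (w i) (w j) = A i j
    rw [hL, Finset.sum_eq_single i, Finset.sum_eq_single j]
    · simp
    · intro b _ hb; simp [hb.symm]
    · simp
    · intro b _ hb; simp [hb.symm]
    · simp

theorem mem_positiveDefinite_iff (h : InnerProducts W) :
    h ∈ positiveDefinite W ↔ (Matrix.of (gram w h)).PosDef := by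
  -- Inner products are linear in the first argument and Mathlib's quadratic form is x* G x, so the
  -- vector with conjugate coordinates appears.
  have key : ∀ x : ι → ℂ, star x ⬝ᵥ ((Matrix.of (gram w h)) *ᵥ x) =
      h.val (w.equivFun.symm (star x)) (w.equivFun.symm (star x)) := by
    intro x
    simp only [Module.Basis.equivFun_symm_apply, val_sum_sum, dotProduct, Matrix.mulVec,
      Finset.mul_sum]
    refine Finset.sum_congr rfl fun i _ => Finset.sum_congr rfl fun j _ => ?_
    simp only [Pi.star_apply, RCLike.star_def, Complex.conj_conj, Matrix.of_apply, gram_apply]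
    ring
  have him : ∀ s, (h.val s s).im = 0 := fun s => Complex.conj_eq_iff_im.1 (h.val_conj s s)
  constructor
  · intro hh
    refine Matrix.PosDef.of_dotProduct_mulVec_pos (isHermitian_gram w h) fun x hx => ?_
    rw [key, Complex.pos_iff]
    refine ⟨hh _ ?_, (him _).symm⟩
    rw [Ne, LinearEquiv.map_eq_zero_iff, star_eq_zero]
    exact hx
  · intro hh s hs
    have := hh.dotProduct_mulVec_pos (x := star (w.equivFun s)) (by
      rw [Ne, star_eq_zero, LinearEquiv.map_eq_zero_iff]; exact hs)
    rw [key, star_star, LinearEquiv.symm_apply_apply] at this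
    exact (Complex.pos_iff.1 this).1

theorem det_gram_ne_zero {h : InnerProducts W} (hh : h ∈ positiveDefinite W) :
    (Matrix.of (gram w h)).det ≠ 0 :=
  ((mem_positiveDefinite_iff w h).1 hh).det_pos.ne'

/-- A continuous left inverse of the Gram matrix map. -/
noncomputable def ofGram : (ι → ι → ℂ) →L[ℝ] InnerProducts W :=
  LinearMap.toContinuousLinearMap (LinearMap.exists_leftInverse_of_injective
    (gram w : InnerProducts W →ₗ[ℝ] (ι → ι → ℂ))
    (LinearMap.ker_eq_bot.2 (gram_injective w))).choose

theorem ofGram_gram (h : InnerProducts W) : ofGram w (gram w h) = h :=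
  LinearMap.congr_fun (LinearMap.exists_leftInverse_of_injective
    (gram w : InnerProducts W →ₗ[ℝ] (ι → ι → ℂ))
    (LinearMap.ker_eq_bot.2 (gram_injective w))).choose_spec h

/-- `ofGram` is an arbitrary linear left inverse on all matrices. It is a right inverse only on the
range of `gram`, which contains the hermitian matrices. -/
theorem gram_ofGram {A : ι → ι → ℂ} (hA : (Matrix.of A).IsHermitian) :
    gram w (ofGram w A) = A := by
  obtain ⟨h, rfl⟩ := exists_gram_eq w hA
  rw [ofGram_gram]

theorem finiteDimensional (w : Module.Basis ι ℂ W) : FiniteDimensional ℝ (InnerProducts W) :=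
  FiniteDimensional.of_injective (gram w : InnerProducts W →ₗ[ℝ] (ι → ι → ℂ)) (gram_injective w)

/-- The inner product whose Gram matrix is the transposed inverse of the one of `h`. -/
noncomputable def dual (h : InnerProducts W) : InnerProducts W :=
  ofGram w (invTranspose (gram w h))

theorem gram_dual {h : InnerProducts W} (hh : h ∈ positiveDefinite W) :
    gram w (dual w h) = invTranspose (gram w h) :=
  gram_ofGram w (posDef_invTranspose ((mem_positiveDefinite_iff w h).1 hh)).isHermitian

theorem dual_mem {h : InnerProducts W} (hh : h ∈ positiveDefinite W) :
    dual w h ∈ positiveDefinite W := by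
  rw [mem_positiveDefinite_iff w, gram_dual w hh]
  exact posDef_invTranspose ((mem_positiveDefinite_iff w h).1 hh)

theorem dual_dual {h : InnerProducts W} (hh : h ∈ positiveDefinite W) :
    dual w (dual w h) = h := by
  apply gram_injective w
  rw [gram_dual w (dual_mem w hh), gram_dual w hh, invTranspose_invTranspose (det_gram_ne_zero w hh)]

/-- By homogeneity, positivity has to be tested only on the unit sphere of the coordinate space. The
sphere is compact and the value is jointly continuous in the inner product and the vector, so
positivity persists nearby. -/
theorem isOpen_positiveDefinite (w : Module.Basis ι ℂ W) : IsOpen (positiveDefinite W) := by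
  have hs : positiveDefinite W = {h | ∀ c ∈ Metric.sphere (0 : ι → ℂ) 1,
      0 < (h.val (w.equivFun.symm c) (w.equivFun.symm c)).re} := by
    ext h
    constructor
    · intro hh c hc
      refine hh _ ?_
      rw [Ne, LinearEquiv.map_eq_zero_iff]
      exact ne_zero_of_mem_unit_sphere ⟨c, hc⟩
    · intro hh s hs
      have hc : w.equivFun s ≠ 0 := by rwa [Ne, LinearEquiv.map_eq_zero_iff]
      have hn : 0 < ‖w.equivFun s‖ := norm_pos_iff.2 hc
      have h1 := hh ((‖w.equivFun s‖⁻¹ : ℂ) • w.equivFun s) (by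
        rw [mem_sphere_zero_iff_norm, norm_smul, norm_inv, Complex.norm_real, norm_norm,
          inv_mul_cancel₀ hn.ne'])
      -- Sums over one index express that scaling the vector by c multiplies the value by |c|².
      have h2 := h.val_sum_sum (Finset.univ : Finset Unit) (Finset.univ : Finset Unit)
        (fun _ => (‖w.equivFun s‖⁻¹ : ℂ)) (fun _ => (‖w.equivFun s‖⁻¹ : ℂ)) (fun _ => s)
        (fun _ => s)
      rw [map_smul, LinearEquiv.symm_apply_apply] at h1
      simp only [Finset.univ_unique, Finset.sum_singleton, ← Complex.ofReal_inv,
        Complex.conj_ofReal, ← Complex.ofReal_mul] at h1 h2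
      rw [h2, Complex.re_ofReal_mul] at h1
      exact (pos_iff_pos_of_mul_pos h1).1 (by positivity)
  rw [hs, isOpen_iff_eventually]
  intro h hh
  refine (isCompact_sphere (0 : ι → ℂ) 1).eventually_forall_of_forall_eventually fun c hc => ?_
  have hcont : Continuous fun p : InnerProducts W × (ι → ℂ) =>
      (p.1.val (w.equivFun.symm p.2) (w.equivFun.symm p.2)).re := by
    simp only [Module.Basis.equivFun_symm_apply, val_sum_sum]
    refine Complex.continuous_re.comp (continuous_finsetSum _ fun i _ =>
      continuous_finsetSum _ fun j _ => ?_)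
    exact (((continuous_apply i).comp continuous_snd).mul
      (Complex.continuous_conj.comp ((continuous_apply j).comp continuous_snd))).mul
      ((continuous_val _ _).comp continuous_fst)
  exact hcont.continuousAt.eventually (lt_mem_nhds (hh c hc))

theorem isSmoothOn_dual : IsSmoothOn (dual w) (positiveDefinite W) := by
  intro k
  have h1 : IsCk k (invTranspose ∘ gram w) (positiveDefinite W) :=
    (contDiffOn_invTranspose.isCk isOpen_det_ne_zero).comp (isOpen_positiveDefinite w)
      isOpen_det_ne_zero (IsCk.continuousLinearMap _ _) fun h hh => det_gram_ne_zero w hh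
  exact (IsCk.continuousLinearMap (ofGram w) univ).comp (isOpen_positiveDefinite w) isOpen_univ h1
    (mapsTo_univ _ _)

theorem exists_isOrthonormal [FiniteDimensional ℂ W] {h : InnerProducts W}
    (hh : h ∈ positiveDefinite W) :
    ∃ (d : ℕ) (s : Module.Basis (Fin d) ℂ W), IsOrthonormal h s := by
  let core : InnerProductSpace.Core ℂ W :=
    -- The arguments are exchanged because Mathlib's inner products are conjugate linear in the
    -- first one.
    { inner := fun x y => h.val y x
      conj_inner_symm := fun x y => h.val_conj y x
      re_inner_nonneg := fun x => by
        rcases eq_or_ne x 0 with rfl | hx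
        · simp [val]
        · exact (hh x hx).le
      add_left := fun x y z => by simp [val]
      smul_left := fun x y r => by simp [val]
      definite := fun x hx => by
        by_contra hne
        have := hh x hne
        rw [show h.val x x = 0 from hx] at this
        exact lt_irrefl _ this }
  let _ : NormedAddCommGroup W := core.toNormedAddCommGroup
  let _ : InnerProductSpace ℂ W := InnerProductSpace.ofCore core.toCore
  refine ⟨_, (stdOrthonormalBasis ℂ W).toBasis, fun i j => ?_⟩
  have h1 := orthonormal_iff_ite.1 (stdOrthonormalBasis ℂ W).orthonormal j i
  simp only [eq_comm (a := j)] at h1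
  rw [← h1]
  simp only [OrthonormalBasis.coe_toBasis]
  rfl

/-- The coordinates of an orthonormal basis determine the inverse of the Gram matrix. -/
theorem invTranspose_gram_eq {h : InnerProducts W} {d : ℕ} (s : Module.Basis (Fin d) ℂ W)
    (hs : IsOrthonormal h s) (i k : ι) :
    invTranspose (gram w h) i k = ∑ j, w.repr (s j) i * conj (w.repr (s j) k) := by
  set B : Matrix ι (Fin d) ℂ := w.toMatrix s with hB
  set B' : Matrix (Fin d) ι ℂ := s.toMatrix w with hB'
  have hBB' : B * B' = 1 := w.toMatrix_mul_toMatrix_flip s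
  have hB'B : B' * B = 1 := s.toMatrix_mul_toMatrix_flip w
  -- Expanding w in the orthonormal basis gives G as B'ᵀ times the conjugate of B', where B' is the
  -- inverse of B. Hence G⁻¹ is the conjugate of B times Bᵀ, and its transpose is B B*.
  have hG : Matrix.of (gram w h) = B'ᵀ * B'.map conj := by
    ext i k
    rw [Matrix.of_apply, gram_apply, ← s.sum_repr (w i), ← s.sum_repr (w k), val_sum_sum,
      Matrix.mul_apply]
    refine Finset.sum_congr rfl fun j _ => ?_
    rw [Finset.sum_eq_single j]
    · rw [hs, if_pos rfl, mul_one]; rfl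
    · intro l _ hl; rw [hs, if_neg hl.symm, mul_zero]
    · simp
  have hinv : (Matrix.of (gram w h))⁻¹ = B.map conj * Bᵀ := by
    refine Matrix.inv_eq_right_inv ?_
    rw [hG, Matrix.mul_assoc, ← Matrix.mul_assoc (B'.map conj), ← Matrix.map_mul, hB'B,
      Matrix.map_one _ (map_zero _) (map_one _), Matrix.one_mul, ← Matrix.transpose_mul, hBB',
      Matrix.transpose_one]
  rw [invTranspose, hinv, Matrix.mul_apply]
  refine Finset.sum_congr rfl fun j _ => ?_
  rw [mul_comm]; rfl

end InnerProducts

end Gram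

/-! ### Submanifolds of finite dimensional subspaces -/

section FiniteDimensionalSubspace

universe u v

variable {M : Type u} [AddCommGroup M] [Module ℝ M] [TopologicalSpace M]
  {P : Type v} [AddCommGroup P] [Module ℝ P] [TopologicalSpace P]

/-- A linear injection of a finite dimensional space into a Fréchet space has a continuous left
inverse. -/
theorem exists_continuousLinearMap_leftInverse (hM : IsFrechetSpace M) [IsTopologicalAddGroup P]
    [ContinuousSMul ℝ P] [T2Space P] [FiniteDimensional ℝ P] {τ : P →ₗ[ℝ] M}
    (hτ : Function.Injective τ) : ∃ l : M →L[ℝ] P, ∀ p, l (τ p) = p := by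
  have := hM.isTopologicalAddGroup
  have := hM.continuousSMul
  have := hM.locallyConvexSpace
  have := hM.metrizableSpace
  let e : P ≃ₗ[ℝ] LinearMap.range τ := LinearEquiv.ofInjective τ hτ
  -- The inverse on the finite dimensional range is automatically continuous, and Hahn–Banach
  -- extends it to all of M.
  obtain ⟨g, hg⟩ := ContinuousLinearMap.exist_extension_of_finiteDimensional_range
    (LinearMap.toContinuousLinearMap (e.symm : LinearMap.range τ →ₗ[ℝ] P))
  refine ⟨g, fun p => ?_⟩
  have h := DFunLike.congr_fun hg (e p)
  simp only [LinearMap.coe_toContinuousLinearMap', LinearEquiv.coe_coe,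
    LinearEquiv.symm_apply_apply] at h
  exact h.symm

/-- The image of an open subset of a finite dimensional space under a linear map with a continuous
left inverse is a submanifold. -/
theorem isSubmanifold_image (hM : IsFrechetSpace M) {τ : P →L[ℝ] M} {l : M →L[ℝ] P}
    (hl : ∀ p, l (τ p) = p) {A : Set P} (hA : IsOpen A) : IsSubmanifold (τ '' A) := by
  have := hM.isTopologicalAddGroup
  have := hM.continuousSMul
  have := hM.metrizableSpace
  rintro _ ⟨p, hp, rfl⟩
  -- The chart is a translation restricted to the preimage of `A` under l. There, membership in τ(A)
  -- reduces to the linear condition τ(l x) = x, which also shows that the range of τ is closed.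
  let e : OpenPartialHomeomorph M M :=
    (Homeomorph.addRight (-τ p)).toOpenPartialHomeomorph.restrOpen (l ⁻¹' A)
      (hA.preimage l.continuous)
  have hes : e.source = l ⁻¹' A := by simp [e]
  have he : ∀ x, e x = x + -τ p := fun x => rfl
  have hes' : ∀ x, e.symm x = x + τ p := fun x => by
    change x + - -τ p = x + τ p
    rw [neg_neg]
  have het : e.target = (fun x => x + τ p) ⁻¹' (l ⁻¹' A) := by
    ext x
    simp only [mem_preimage, ← hes']
    simp [e]
  have hr : ∀ x, x ∈ LinearMap.range (τ : P →ₗ[ℝ] M) ↔ τ (l x) = x := by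
    intro x
    constructor
    · rintro ⟨q, rfl⟩; exact congrArg τ (hl q)
    · intro h; exact ⟨l x, h⟩
  refine ⟨M, _, _, _, hM, e, LinearMap.range (τ : P →ₗ[ℝ] M), ?_, ?_, ?_, ?_, ?_, ?_⟩
  · rw [hes, mem_preimage, hl]; exact hp
  · rw [het, mem_preimage, mem_preimage, zero_add, hl]; exact hp
  · exact fun k => (IsCk.continuousLinearMap (ContinuousLinearMap.id ℝ M) e.source).add_const _
  · intro k
    have h := (IsCk.continuousLinearMap (k := k) (ContinuousLinearMap.id ℝ M) e.target).add_const
      (τ p)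
    exact h.congr e.open_target fun x _ => (hes' x).symm
  · have h : (LinearMap.range (τ : P →ₗ[ℝ] M) : Set M) = {x | τ (l x) = x} := Set.ext hr
    rw [h]
    exact isClosed_eq (τ.continuous.comp l.continuous) continuous_id
  · ext y
    constructor
    · rintro ⟨_, ⟨hx, q, hq, rfl⟩, rfl⟩
      exact ⟨e.map_source hx, q - p, by rw [he]; simp [sub_eq_add_neg]⟩
    · rintro ⟨hy, q, hq⟩
      have hy' := e.map_target hy
      refine ⟨e.symm y, ⟨hy', l (e.symm y), by rwa [hes] at hy', ?_⟩, e.right_inv hy⟩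
      refine (hr _).1 ⟨q + p, ?_⟩
      rw [hes', ← hq]
      exact map_add τ q p

/-- A map that is the composition of an involution of an open subset `A` of a finite dimensional
space and a linear map with a continuous left inverse is a diffeomorphism onto its image. -/
theorem isDiffeomorphismOnto_image (hM : IsFrechetSpace M) [IsTopologicalAddGroup P]
    [ContinuousSMul ℝ P] [LocallyConvexSpace ℝ P] [T2Space P] {τ : P →L[ℝ] M} {l : M →L[ℝ] P}
    (hl : ∀ p, l (τ p) = p) {A : Set P} (hA : IsOpen A) {σ : P → P} (hσ : IsSmoothOn σ A)
    (hσA : ∀ p ∈ A, σ p ∈ A) (hσσ : ∀ p ∈ A, σ (σ p) = p) {b : P → M}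
    (hb : ∀ p ∈ A, b p = τ (σ p)) : IsDiffeomorphismOnto b A (b '' A) := by
  have := hM.isTopologicalAddGroup
  have := hM.continuousSMul
  have := hM.locallyConvexSpace
  have := hM.metrizableSpace
  have hbA : IsSmoothOn b A := fun k =>
    ((IsCk.continuousLinearMap τ univ).comp hA isOpen_univ (hσ k) (mapsTo_univ _ _)).congr hA
      fun p hp => (hb p hp).symm
  refine ⟨hA, ⟨mapsTo_image _ _, ?_, surjOn_image _ _⟩, ?_⟩
  · intro p hp q hq h
    rw [hb p hp, hb q hq] at h
    have h' := congrArg l h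
    rw [hl, hl] at h'
    rw [← hσσ p hp, h', hσσ q hq]
  · intro F _ _ _ hF Φ G hΦ
    have := hF.isTopologicalAddGroup
    have := hF.continuousSMul
    have := hF.locallyConvexSpace
    have := hF.metrizableSpace
    have hO : IsOpen (A ∩ b ⁻¹' Φ.source) :=
      ((hbA 0).continuousOn hA).isOpen_inter_preimage hA Φ.open_source
    have hmem : ∀ p ∈ A ∩ b ⁻¹' Φ.source, Φ (b p) ∈ G := fun p hp =>
      (hΦ.image_eq.subset ⟨b p, ⟨hp.2, mem_image_of_mem b hp.1⟩, rfl⟩).2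
    refine ⟨hO, ?_, ?_⟩
    · classical
      -- The value 0 is taken only where Φ(b p) is not in `G`, which does not happen on the set
      -- considered.
      let g : P → G := fun p => if h : Φ (b p) ∈ G then ⟨Φ (b p), h⟩ else 0
      have hg : ∀ p ∈ A ∩ b ⁻¹' Φ.source, (g p : F) = Φ (b p) := fun p hp => by
        simp only [g, dif_pos (hmem p hp)]
      refine ⟨g, hg, fun k => ?_⟩
      have h1 : IsCk k (Φ ∘ b) (A ∩ b ⁻¹' Φ.source) :=
        (hΦ.smooth k).comp hO Φ.open_source ((hbA k).mono inter_subset_left) fun p hp => hp.2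
      exact h1.codRestrict hΦ.isClosed hO hg
    -- In every chart the inverse is σ ∘ l ∘ Φ⁻¹. A point Φ⁻¹(v) of the image is τ(σ q) for some q
    -- in `A`; l recovers σ q and the involution recovers q.
    · refine ⟨fun v => σ (l (Φ.symm v)), fun v hv => ?_, fun k => ?_⟩
      · obtain ⟨x, ⟨hx, q, hq, hqx⟩, hxv⟩ := hΦ.image_eq.symm.subset ⟨hv, v.2⟩
        have h1 : Φ.symm v = τ (σ q) := by rw [← hxv, Φ.left_inv hx, ← hqx, hb q hq]
        change σ (l (Φ.symm v)) ∈ A ∧ b (σ (l (Φ.symm v))) = Φ.symm v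
        rw [h1, hl, hσσ q hq, hb q hq]
        exact ⟨hq, rfl⟩
      · have hV : IsOpen {v : G | (v : F) ∈ Φ.target} := Φ.open_target.preimage G.subtypeL.continuous
        have h1 : IsCk k (Φ.symm ∘ G.subtypeL) {v : G | (v : F) ∈ Φ.target} :=
          (hΦ.smooth_symm k).comp_continuousLinearMap G.subtypeL
        have h2 : IsCk k (l ∘ (Φ.symm ∘ G.subtypeL)) {v : G | (v : F) ∈ Φ.target} :=
          (IsCk.continuousLinearMap l univ).comp hV isOpen_univ h1 (mapsTo_univ _ _)
        refine (hσ k).comp hV hA h2 fun v hv => ?_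
        obtain ⟨x, ⟨hx, q, hq, hqx⟩, hxv⟩ := hΦ.image_eq.symm.subset ⟨hv, v.2⟩
        have h3 : Φ.symm v = τ (σ q) := by rw [← hxv, Φ.left_inv hx, ← hqx, hb q hq]
        change l (Φ.symm v) ∈ A
        rw [h3, hl]
        exact hσA q hq

end FiniteDimensionalSubspace

/-! ### The Bergman section -/

section Bergman

variable {V : Type*} [NormedAddCommGroup V] [NormedSpace ℂ V]
  {X : Type*} [TopologicalSpace X] [ChartedSpace V X] [IsManifold 𝓘(ℂ, V) ω X]
  {F : Type*} [NormedAddCommGroup F] [NormedSpace ℂ F]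
  {E : X → Type*} [∀ x, AddCommGroup (E x)] [∀ x, Module ℂ (E x)]
  [∀ x, TopologicalSpace (E x)] [TopologicalSpace (TotalSpace F E)]
  [FiberBundle F E] [VectorBundle ℂ F E] [ContMDiffVectorBundle ω F E 𝓘(ℂ, V)]

variable {ι : Type*} [Fintype ι] [DecidableEq ι]

theorem tmulSection_sum_sum (I J : Finset ι) (a b : ι → ℂ)
    (w v : ι → HolomorphicSections V F E) :
    tmulSection (∑ i ∈ I, a i • w i) (∑ j ∈ J, b j • v j) =
      ∑ i ∈ I, ∑ j ∈ J, (a i * conj (b j)) • tmulSection (w i) (v j) := by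
  have h (I : Finset ι) (a : ι → ℂ) (w : ι → HolomorphicSections V F E) (x : X) :
      (∑ i ∈ I, a i • w i) x = ∑ i ∈ I, a i • w i x := by
    induction I using Finset.cons_induction with
    | empty => rfl
    | cons i I hi ih =>
      rw [Finset.sum_cons, Finset.sum_cons, ContMDiffSection.coe_add, Pi.add_apply, ih]; rfl
  refine SmoothSections.ext fun x => ?_
  simp only [SmoothSections.val_sum, SmoothSections.val_smul, Pi.smul_apply, tmulSection_val, h,
    toConj_sum, toConj_smul, TensorProduct.sum_tmul, TensorProduct.tmul_sum,
    TensorProduct.smul_tmul_smul]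
  exact Finset.sum_comm

variable (w : Module.Basis ι ℂ (HolomorphicSections V F E))

/-- The linear map that sends an inner product with Gram matrix `(hᵢⱼ)` to the section
`∑ hᵢⱼ wᵢ ⊗ wⱼ`. -/
noncomputable def gramSection : InnerProducts (HolomorphicSections V F E) →ₗ[ℝ]
    SmoothSections V F E where
  toFun h := ∑ i, ∑ j, InnerProducts.gram w h i j • tmulSection (w i) (w j)
  map_add' h h' := by
    simp only [map_add, Pi.add_apply, add_smul, Finset.sum_add_distrib]
  map_smul' c h := by
    simp only [map_smul, Pi.smul_apply, smul_assoc, Finset.smul_sum, RingHom.id_apply]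

/-- Polarization shows that the Gram matrix of an inner product in the kernel vanishes, and the Gram
matrix determines the inner product. -/
theorem gramSection_injective [ConnectedSpace X] : Function.Injective (gramSection w) := by
  refine (injective_iff_map_eq_zero _).2 fun h hh => ?_
  apply InnerProducts.gram_injective w
  rw [map_zero]
  exact eq_zero_of_sum_tmulSection_eq_zero w.linearIndependent hh

/-- Expanding each s_j in the basis w, the coefficient of w_i ⊗ w_k is an entry of the transposed
inverse Gram matrix. The right side does not involve s, so this also proves independence of the
orthonormal basis. -/
theorem sum_tmulSelf_eq {h : InnerProducts (HolomorphicSections V F E)}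
    (hh : h ∈ positiveDefinite (HolomorphicSections V F E)) {d : ℕ}
    (s : Module.Basis (Fin d) ℂ (HolomorphicSections V F E)) (hs : IsOrthonormal h s) :
    ∑ j, tmulSelf (s j) = gramSection w (InnerProducts.dual w h) := by
  have h1 : ∀ j, tmulSelf (s j) = ∑ i, ∑ k, (w.repr (s j) i * conj (w.repr (s j) k)) •
      tmulSection (w i) (w k) := by
    intro j
    rw [← tmulSection_sum_sum, w.sum_repr]
    rfl
  simp only [h1]
  change _ = ∑ i, ∑ k, InnerProducts.gram w (InnerProducts.dual w h) i k • _
  rw [InnerProducts.gram_dual w hh, Finset.sum_comm]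
  refine Finset.sum_congr rfl fun i _ => ?_
  rw [Finset.sum_comm]
  refine Finset.sum_congr rfl fun k _ => ?_
  rw [InnerProducts.invTranspose_gram_eq w s hs, Finset.sum_smul]

theorem bergmanSection_eq [FiniteDimensional ℂ (HolomorphicSections V F E)]
    {h : InnerProducts (HolomorphicSections V F E)}
    (hh : h ∈ positiveDefinite (HolomorphicSections V F E)) :
    bergmanSection h = gramSection w (InnerProducts.dual w h) := by
  have hs := InnerProducts.exists_isOrthonormal hh
  rw [bergmanSection, dif_pos hs]
  exact sum_tmulSelf_eq w hh _ hs.choose_spec.choose_spec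

end Bergman

end Bergman

theorem theorem1p2
    {V : Type*} [NormedAddCommGroup V] [NormedSpace ℂ V] [FiniteDimensional ℂ V]
    {X : Type*} [TopologicalSpace X] [T2Space X] [CompactSpace X] [ConnectedSpace X]
    [ChartedSpace V X] [IsManifold 𝓘(ℂ, V) ω X]
    {F : Type*} [NormedAddCommGroup F] [NormedSpace ℂ F] [FiniteDimensional ℂ F]
    (E : X → Type*) [∀ x, AddCommGroup (E x)] [∀ x, Module ℂ (E x)]
    [∀ x, TopologicalSpace (E x)] [TopologicalSpace (TotalSpace F E)]
    [FiberBundle F E] [VectorBundle ℂ F E] [ContMDiffVectorBundle ω F E 𝓘(ℂ, V)] :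
    -- `b` is well defined, and takes values in a Fréchet space
    FiniteDimensional ℂ (Bergman.HolomorphicSections V F E) ∧
    (∀ h ∈ Bergman.positiveDefinite (Bergman.HolomorphicSections V F E),
      (∃ (d : ℕ) (s : Module.Basis (Fin d) ℂ (Bergman.HolomorphicSections V F E)),
        Bergman.IsOrthonormal h s) ∧
      ∀ (d : ℕ) (s : Module.Basis (Fin d) ℂ (Bergman.HolomorphicSections V F E)),
        Bergman.IsOrthonormal h s →
        ∀ x : X, (Bergman.bergmanSection h).val x = ∑ j, s j x ⊗ₜ[ℂ] Bergman.toConj (s j x)) ∧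
    Bergman.IsFrechetSpace (Bergman.SmoothSections V F E) ∧
    -- the image of `b` is a submanifold, and `b` is a diffeomorphism onto it
    Bergman.IsSubmanifold
      (Bergman.bergmanSection '' Bergman.positiveDefinite (Bergman.HolomorphicSections V F E) :
        Set (Bergman.SmoothSections V F E)) ∧
    Bergman.IsDiffeomorphismOnto (M := Bergman.SmoothSections V F E) Bergman.bergmanSection
      (Bergman.positiveDefinite (Bergman.HolomorphicSections V F E))
      (Bergman.bergmanSection '' Bergman.positiveDefinite (Bergman.HolomorphicSections V F E)) := by
  have hfd := Bergman.finiteDimensional_holomorphicSections V F E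
  have hM := Bergman.isFrechetSpace_smoothSections (V := V) (F := F) (E := E)
  let w := Module.finBasis ℂ (Bergman.HolomorphicSections V F E)
  have hPfd := Bergman.InnerProducts.finiteDimensional w
  obtain ⟨l, hl⟩ := Bergman.exists_continuousLinearMap_leftInverse hM
    (Bergman.gramSection_injective w)
  let τ : Bergman.InnerProducts (Bergman.HolomorphicSections V F E) →L[ℝ]
    Bergman.SmoothSections V F E := LinearMap.toContinuousLinearMap (Bergman.gramSection w)
  have hτ : ∀ p, l (τ p) = p := hl
  have hA := Bergman.InnerProducts.isOpen_positiveDefinite w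
  have hb : ∀ h ∈ Bergman.positiveDefinite (Bergman.HolomorphicSections V F E),
      Bergman.bergmanSection h = τ (Bergman.InnerProducts.dual w h) :=
    fun h hh => Bergman.bergmanSection_eq w hh
  refine ⟨hfd, fun h hh => ⟨Bergman.InnerProducts.exists_isOrthonormal hh, fun d s hs x => ?_⟩, hM,
    ?_, ?_⟩
  · rw [Bergman.bergmanSection_eq w hh, ← Bergman.sum_tmulSelf_eq w hh s hs,
      Bergman.SmoothSections.val_sum]
    rfl
  -- The involution σ maps the cone onto itself, so b and the linear map τ have the same image.
  · have himage : Bergman.bergmanSection ''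
        Bergman.positiveDefinite (Bergman.HolomorphicSections V F E) =
        τ '' Bergman.positiveDefinite (Bergman.HolomorphicSections V F E) := by
      ext k
      constructor
      · rintro ⟨h, hh, rfl⟩
        exact ⟨_, Bergman.InnerProducts.dual_mem w hh, (hb h hh).symm⟩
      · rintro ⟨h, hh, rfl⟩
        refine ⟨_, Bergman.InnerProducts.dual_mem w hh, ?_⟩
        rw [hb _ (Bergman.InnerProducts.dual_mem w hh), Bergman.InnerProducts.dual_dual w hh]
    rw [himage]
    exact Bergman.isSubmanifold_image hM hτ hA
  · exact Bergman.isDiffeomorphismOnto_image hM hτ hA (Bergman.InnerProducts.isSmoothOn_dual w)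
      (fun p hp => Bergman.InnerProducts.dual_mem w hp)
      (fun p hp => Bergman.InnerProducts.dual_dual w hp) hb
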